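/- Let $A$ be a finite alphabet with $r\ge 2$ letters and $F_r=F(A)$ the free group on $A$. A Stallings graph of size $n\ge 1$ is a set $E\subseteq [n]\times A\times[n]$ of labelled edges such that each letter $a$ labels a partial injection of $[n]=\{1,\dots,n\}$ (that is, $(u,a,v),(u,a,v')\in E$ implies $v=v'$, and $(u,a,v),(u',a,v)\in E$ implies $u=u'$), the underlying undirected graph is connected, and every vertex other than $1$ has degree at least $2$ (a loop counts twice). Let $H(\Gamma)\le F(A)$ be the (finitely generated) subgroup of the elements represented by words labelling a loop at $1$ in $\Gamma$, where an edge $(u,a,v)$ is read from $u$ to $v$ as $a$ and from $v$ to $u$ as $a^{-1}$, and let $\langle A\mid\Gamma\rangle$ be the quotient of $F(A)$ by the normal closure of $H(\Gamma)$. A subgroup of $F_r$ has size $n$ if it is $H(\Gamma)$ for some Stallings graph $\Gamma$ of size $n$. Theorem. Generically, the group $\langle A\mid\Gamma\rangle$ is trivial; in other words, generically, the normal closure of a random size-$n$ subgroup of $F_r$ is all of $F_r$. Precisely, each of the following probabilities tends to $1$ as $n\to\infty$: (1) the probability that $\langle A\mid\Gamma\rangle$ is trivial, for $\Gamma$ chosen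 uniformly among the Stallings graphs of size $n$, and likewise for $\Gamma$ chosen uniformly among those of size at most $n$; (2) the probability that the normal closure of $H$ is $F_r$, for $H$ chosen uniformly among the subgroups of $F_r$ of size $n$, and likewise for $H$ chosen uniformly among those of size at most $n$. -/

import Mathlib

/-- An `A`-graph on the vertex set `V`: a set of edges `(u, a, v)` such that every letter
labels a partial injection of `V`. -/
structure AGraph (A V : Type*) where
  /-- the labelled edges -/
  edges : Set (V × A × V)
  det : ∀ u a v v', (u, a, v) ∈ edges → (u, a, v') ∈ edges → v = v'
  codet : ∀ u u' a v, (u, a, v) ∈ edges → (u', a, v) ∈ edges → u = u'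

namespace AGraph

/-- The underlying undirected graph; loops and multiplicities are irrelevant for connectedness. -/
def toSimpleGraph {A V : Type*} (Γ : AGraph A V) : SimpleGraph V :=
  SimpleGraph.fromRel (fun u v => ∃ a, (u, a, v) ∈ Γ.edges)

/-- The number of occurrences of `v` in the list of triples defining the edges
(so a loop at `v` counts twice). -/
noncomputable def degree {A V : Type*} (Γ : AGraph A V) (v : V) : ℕ∞ :=
  {p : A × V | (v, p.1, p.2) ∈ Γ.edges}.encard + {p : V × A | (p.1, p.2, v) ∈ Γ.edges}.encard

/-- A leaf is a vertex that occurs at most once in the list of edges. -/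
def IsLeaf {A V : Type*} (Γ : AGraph A V) (v : V) : Prop := Γ.degree v ≤ 1

/-- The pair `(Γ, v)` is admissible if `Γ` is finite, connected, and has no leaf except
perhaps `v`. -/
structure Admissible {A V : Type*} (Γ : AGraph A V) (v : V) : Prop where
  finite : Finite V
  connected : Γ.toSimpleGraph.Connected
  trim : ∀ w, w ≠ v → ¬ Γ.IsLeaf w

/-- Reading one letter: `(a, true)` stands for `a` and `(a, false)` for `a⁻¹`, as in
`FreeGroup`; an edge `(u, a, v)` is read from `u` to `v` as `a` and from `v` to `u` as `a⁻¹`. -/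
def Step {A V : Type*} (Γ : AGraph A V) (u : V) : A × Bool → V → Prop
  | (a, true), v => (u, a, v) ∈ Γ.edges
  | (a, false), v => (v, a, u) ∈ Γ.edges

/-- `Γ.Reads L u v`: the word `L` labels a path from `u` to `v`. -/
def Reads {A V : Type*} (Γ : AGraph A V) : List (A × Bool) → V → V → Prop
  | [], u, v => u = v
  | x :: L, u, v => ∃ z, Γ.Step u x z ∧ Γ.Reads L z v

theorem reads_append {A V : Type*} (Γ : AGraph A V) (L M : List (A × Bool)) (u w : V) :
    Γ.Reads (L ++ M) u w ↔ ∃ z, Γ.Reads L u z ∧ Γ.Reads M z w := by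
  induction L generalizing u with
  | nil => simp [Reads]
  | cons x L ih =>
    simp only [List.cons_append, Reads, ih]
    constructor
    · rintro ⟨y, h, z, h1, h2⟩
      exact ⟨z, ⟨y, h, h1⟩, h2⟩
    · rintro ⟨z, ⟨y, h, h1⟩, h2⟩
      exact ⟨y, h, z, h1, h2⟩

theorem step_not {A V : Type*} (Γ : AGraph A V) (a : A) (b : Bool) (u v : V) :
    Γ.Step u (a, !b) v ↔ Γ.Step v (a, b) u := by
  cases b <;> exact Iff.rfl

theorem step_unique {A V : Type*} (Γ : AGraph A V) (x : A × Bool) (u v v' : V)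
    (h : Γ.Step u x v) (h' : Γ.Step u x v') : v = v' := by
  obtain ⟨a, b⟩ := x
  cases b
  · exact Γ.codet _ _ _ _ h h'
  · exact Γ.det _ _ _ _ h h'

theorem reads_invRev {A V : Type*} (Γ : AGraph A V) (L : List (A × Bool)) (u w : V)
    (h : Γ.Reads L u w) : Γ.Reads (FreeGroup.invRev L) w u := by
  induction L generalizing u with
  | nil => exact h.symm
  | cons x L ih =>
    obtain ⟨z, h1, h2⟩ := h
    have e : FreeGroup.invRev (x :: L) = FreeGroup.invRev L ++ [(x.1, !x.2)] := by
      simp [FreeGroup.invRev]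
    rw [e, reads_append]
    exact ⟨z, ih z h2, u, (Γ.step_not x.1 x.2 z u).2 h1, rfl⟩

theorem reads_of_red {A V : Type*} (Γ : AGraph A V) (L M : List (A × Bool)) (u w : V)
    (hLM : FreeGroup.Red L M) (h : Γ.Reads L u w) : Γ.Reads M u w := by
  induction hLM with
  | refl => exact h
  | tail _ hs ih =>
    cases hs with
    | not =>
      rw [reads_append] at ih ⊢
      obtain ⟨z, h1, y, h2, y', h3, h4⟩ := ih
      have : y' = z := Γ.step_unique _ y y' z h3 ((Γ.step_not _ _ y z).2 h2)
      exact ⟨z, h1, this ▸ h4⟩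

/-- The subgroup of the free group on `A` represented by `(Γ, v)`: the elements that are
represented by a word labelling a loop at `v`. -/
def subgroupAt {A V : Type*} (Γ : AGraph A V) (v : V) : Subgroup (FreeGroup A) where
  carrier := {g | ∃ L : List (A × Bool), FreeGroup.mk L = g ∧ Γ.Reads L v v}
  one_mem' := ⟨[], rfl, rfl⟩
  mul_mem' := by
    rintro _ _ ⟨L, rfl, hL⟩ ⟨M, rfl, hM⟩
    exact ⟨L ++ M, FreeGroup.mul_mk.symm, (Γ.reads_append L M v v).2 ⟨v, hL, hM⟩⟩
  inv_mem' := by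
    rintro _ ⟨L, rfl, hL⟩
    exact ⟨FreeGroup.invRev L, FreeGroup.inv_mk.symm, Γ.reads_invRev L v v hL⟩

/-- An element belongs to the subgroup represented by `(Γ, v)` if and only if its reduced word
labels a loop at `v`. -/
theorem mem_subgroupAt_iff {A V : Type*} [DecidableEq A] (Γ : AGraph A V) (v : V)
    (g : FreeGroup A) : g ∈ Γ.subgroupAt v ↔ Γ.Reads g.toWord v v := by
  constructor
  · rintro ⟨L, rfl, hL⟩
    rw [FreeGroup.toWord_mk]
    exact Γ.reads_of_red _ _ v v FreeGroup.reduce.red hL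
  · intro h
    exact ⟨g.toWord, FreeGroup.mk_toWord, h⟩

end AGraph

/-- A Stallings graph of size `n`: an admissible pair whose vertex set is an `n`-element set,
normalized to `{0, …, n - 1}` with distinguished vertex `0`. -/
structure StallingsGraph (A : Type*) where
  size : ℕ
  size_pos : 0 < size
  graph : AGraph A (Fin size)
  admissible : graph.Admissible ⟨0, size_pos⟩

namespace StallingsGraph

/-- The (finitely generated) subgroup of which `Γ` is the graphical representation. -/
def subgroup {A : Type*} (Γ : StallingsGraph A) : Subgroup (FreeGroup A) :=
  Γ.graph.subgroupAt ⟨0, Γ.size_pos⟩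

/-- The Stallings graphs of size `n`. -/
def sphere (A : Type*) (n : ℕ) : Set (StallingsGraph A) := {Γ | Γ.size = n}

/-- The group presented by `⟨A | Γ⟩`: the quotient of the free group on `A` by the normal closure
of the subgroup represented by `Γ`. -/
abbrev Presented {A : Type*} (Γ : StallingsGraph A) : Type _ :=
  PresentedGroup (Γ.subgroup : Set (FreeGroup A))

end StallingsGraph

/-- The subgroups of size `n` of the free group on `A`: those represented by a Stallings graph
with `n` vertices (such a subgroup is automatically finitely generated). -/
def subgroupSphere (A : Type*) (n : ℕ) : Set (Subgroup (FreeGroup A)) :=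
  {H | ∃ Γ : StallingsGraph A, Γ.size = n ∧ Γ.subgroup = H}

/-- The probability that a uniformly chosen element of the finite nonempty set `B` is in `X`. -/
noncomputable def proportion {S : Type*} (X B : Set S) : ℝ :=
  ((X ∩ B).ncard : ℝ) / (B.ncard : ℝ)

/-- `X` is generic for the layers `L n` (spheres): the proportion of elements of `X` in
`L n` tends to `1`. -/
def IsSphereGeneric {S : Type*} (L : ℕ → Set S) (X : Set S) : Prop :=
  Filter.Tendsto (fun n => proportion X (L n)) Filter.atTop (nhds 1)

/-- `X` is generic for the layers `L n` (balls): the proportion of elements of `X` among the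
elements of size at most `n` tends to `1`. -/
def IsBallGeneric {S : Type*} (L : ℕ → Set S) (X : Set S) : Prop :=
  Filter.Tendsto (fun n => proportion X (⋃ i ≤ n, L i)) Filter.atTop (nhds 1)

/-! If a letter `a` has a cycle of length `l` in a connected graph, the subgroup contains a
conjugate of `a ^ l`. Two cycles of coprime lengths therefore put `a` itself in the normal closure,
and if this happens for every letter the quotient is trivial (`AGraph.normalClosure_eq_top`). It
remains to see that it almost always happens.

An `A`-graph on `n` vertices is a tuple of partial injections, so a uniform graph has independent
uniform letters. Everything rests on `PInj.tendsto_ratio`: a random partial injection is defined at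
a given point with probability tending to `1`. Hence a random tuple is connected
(`PInj.exists_density_invariant_le`) and leafless (`AGraph.density_leaf_le`) with probability
tending to `1`, so restricting to Stallings graphs costs nothing in the limit. A second-moment
argument, with the divergence of the sum of reciprocals of primes, gives each letter cycles of two
distinct prime lengths (`PInj.tendsto_density_coprimeCycles_compl`).

Subgroups are handled by rigidity: a graph is determined by its subgroup up to a unique based
isomorphism, so all subgroups of size `n` have equally many graphs
(`AGraph.ncard_admissible_subgroupAt`) and proportions agree. Balls follow from spheres by summing
asymptotic equivalents (`IsSphereGeneric.isBallGeneric`). -/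

namespace AGraph

/-! ### Paths in `A`-graphs. -/

variable {A V V' : Type*}

theorem reads_unique (Γ : AGraph A V) (L : List (A × Bool)) (u w w' : V)
    (h : Γ.Reads L u w) (h' : Γ.Reads L u w') : w = w' := by
  induction L generalizing u with
  | nil => exact h.symm.trans h'
  | cons x L ih =>
    obtain ⟨z, h1, h2⟩ := h
    obtain ⟨z', h1', h2'⟩ := h'
    obtain rfl := Γ.step_unique x u z z' h1 h1'
    exact ih z h2 h2'

theorem reads_singleton (Γ : AGraph A V) (x : A × Bool) (u w : V) :
    Γ.Reads [x] u w ↔ Γ.Step u x w := by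
  simp [Reads]

theorem exists_reads_of_reachable (Γ : AGraph A V) {u w : V}
    (h : Γ.toSimpleGraph.Reachable u w) : ∃ L, Γ.Reads L u w := by
  obtain ⟨p⟩ := h
  induction p with
  | nil => exact ⟨[], rfl⟩
  | cons hadj _ ih =>
    obtain ⟨L, hL⟩ := ih
    rw [toSimpleGraph, SimpleGraph.fromRel_adj] at hadj
    obtain ⟨-, ⟨a, ha⟩ | ⟨a, ha⟩⟩ := hadj
    · exact ⟨(a, true) :: L, _, ha, hL⟩
    · exact ⟨(a, false) :: L, _, ha, hL⟩

/-- If `y` were the only letter readable from `w`, determinism would leave a single edge end there.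
With `y` the inverse of the last letter read, this continues a path without backtracking. -/
theorem exists_step_ne (Γ : AGraph A V) {w : V} (hw : ¬ Γ.IsLeaf w) (y : A × Bool) :
    ∃ x z, x ≠ y ∧ Γ.Step w x z := by
  by_contra! hall
  obtain ⟨a, b⟩ := y
  refine hw ?_
  have houtsub : {p : A × V | (w, p.1, p.2) ∈ Γ.edges}.Subsingleton := by
    rintro ⟨c, z⟩ hz ⟨c', z'⟩ hz'
    have h1 : (c, true) = (a, b) := by
      by_contra hne
      exact hall (c, true) z hne hz
    have h2 : (c', true) = (a, b) := by
      by_contra hne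
      exact hall (c', true) z' hne hz'
    obtain rfl : c = c' := by simpa using congrArg Prod.fst (h1.trans h2.symm)
    exact congrArg _ (Γ.det _ _ _ _ hz hz')
  have hinsub : {p : V × A | (p.1, p.2, w) ∈ Γ.edges}.Subsingleton := by
    rintro ⟨z, c⟩ hz ⟨z', c'⟩ hz'
    have h1 : (c, false) = (a, b) := by
      by_contra hne
      exact hall (c, false) z hne hz
    have h2 : (c', false) = (a, b) := by
      by_contra hne
      exact hall (c', false) z' hne hz'
    obtain rfl : c = c' := by simpa using congrArg Prod.fst (h1.trans h2.symm)
    exact congrArg (·, c) (Γ.codet _ _ _ _ hz hz')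
  unfold IsLeaf degree
  cases b
  · have : {p : A × V | (w, p.1, p.2) ∈ Γ.edges} = ∅ := by
      ext ⟨c, z⟩
      simp only [Set.mem_ofPred_eq, Set.mem_empty_iff_false, iff_false]
      exact hall (c, true) z (by simp)
    rw [this, Set.encard_empty, zero_add]
    exact Set.encard_le_one_iff_subsingleton.2 hinsub
  · have : {p : V × A | (p.1, p.2, w) ∈ Γ.edges} = ∅ := by
      ext ⟨z, c⟩
      simp only [Set.mem_ofPred_eq, Set.mem_empty_iff_false, iff_false]
      exact hall (c, false) z (by simp)
    rw [this, Set.encard_empty, add_zero]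
    exact Set.encard_le_one_iff_subsingleton.2 houtsub

end AGraph

/-! ### Reduced words. -/

namespace FreeGroup

theorem IsReduced.append_singleton {A : Type*} {L : List (A × Bool)} {y x : A × Bool}
    (h : IsReduced (L ++ [y])) (hx : x ≠ (y.1, !y.2)) : IsReduced (L ++ [y] ++ [x]) := by
  refine IsReduced.append_overlap h ?_ (by simp)
  simp only [List.cons_append, List.nil_append, isReduced_cons_cons, IsReduced.singleton, and_true]
  intro h1
  by_contra h2
  refine hx (Prod.ext h1.symm ?_)
  simpa [Bool.eq_not] using Ne.symm h2

/-- Each letter of `t` cancels at most one letter, so the buffer `L₂` protects the prefix `L₁`. -/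
theorem exists_red_append {A : Type*} (L₁ L₂ t : List (A × Bool)) (h : IsReduced (L₁ ++ L₂))
    (ht : t.length ≤ L₂.length) :
    ∃ M, IsReduced (L₁ ++ M) ∧ Red (L₁ ++ L₂ ++ t) (L₁ ++ M) := by
  induction t generalizing L₂ with
  | nil => exact ⟨L₂, h, by simpa using Red.refl⟩
  | cons x t ih =>
    rcases List.eq_nil_or_concat L₂ with rfl | ⟨L₃, y, rfl⟩
    · simp at ht
    rw [List.concat_eq_append] at *
    by_cases hx : x = (y.1, !y.2)
    · obtain ⟨M, hM, hred⟩ := ih L₃ (h.infix ⟨[], [y], by simp⟩) (by simpa using ht)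
      refine ⟨M, hM, Relation.ReflTransGen.head ?_ hred⟩
      have := Red.Step.not (L₁ := L₁ ++ L₃) (L₂ := t) (x := y.1) (b := y.2)
      subst hx
      simpa using this
    · obtain ⟨M, hM, hred⟩ := ih (L₃ ++ [y] ++ [x])
        (by
          rw [← List.append_assoc] at h
          simpa using h.append_singleton hx)
        (by simp at ht ⊢; omega)
      exact ⟨M, hM, by simpa using hred⟩

end FreeGroup

/-! ### Rigidity: the subgroup determines the admissible graph. -/

namespace AGraph

open FreeGroup

variable {A V V' : Type*}

/-- Away from `v` there is no leaf, so a reduced path can be prolonged until it meets `v` or is as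
long as desired. -/
theorem Admissible.exists_extension {Γ : AGraph A V} {v : V} (hΓ : Γ.Admissible v)
    (L : List (A × Bool)) (w : V) (hL : IsReduced L) (hr : Γ.Reads L v w) (n : ℕ) :
    ∃ M z, IsReduced (L ++ M) ∧ Γ.Reads (L ++ M) v z ∧ (z = v ∨ n ≤ M.length) := by
  induction n with
  | zero => exact ⟨[], w, by simpa using hL, by simpa using hr, Or.inr le_rfl⟩
  | succ n ih =>
    obtain ⟨M, z, hM, hz, h⟩ := ih
    by_cases hzv : z = v
    · exact ⟨M, z, hM, hz, Or.inl hzv⟩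
    have hn : n ≤ M.length := h.resolve_left hzv
    rcases List.eq_nil_or_concat (L ++ M) with hnil | ⟨K, y, hK⟩
    · rw [hnil] at hz
      exact absurd (Eq.symm hz) hzv
    rw [List.concat_eq_append] at hK
    obtain ⟨x, z', hx, hstep⟩ := Γ.exists_step_ne (hΓ.trim z hzv) (y.1, !y.2)
    refine ⟨M ++ [x], z', ?_, ?_, Or.inr (by simpa using hn)⟩
    · rw [← List.append_assoc, hK]
      rw [hK] at hM
      exact hM.append_singleton hx
    · rw [← List.append_assoc, reads_append]
      exact ⟨z, hz, (Γ.reads_singleton x z z').2 hstep⟩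

theorem Admissible.exists_reads {Γ : AGraph A V} {v : V} (hΓ : Γ.Admissible v) (u w : V) :
    ∃ L, Γ.Reads L u w :=
  Γ.exists_reads_of_reachable (hΓ.connected.preconnected u w)

/-- In an admissible graph every reduced word readable from the base vertex is a prefix of the
reduced word of an element of the subgroup. -/
theorem Admissible.exists_reduced_loop {Γ : AGraph A V} {v : V} (hΓ : Γ.Admissible v)
    (L : List (A × Bool)) (w : V) (hL : IsReduced L) (hr : Γ.Reads L v w) :
    ∃ M, IsReduced (L ++ M) ∧ Γ.Reads (L ++ M) v v := by
  choose t ht using fun u => hΓ.exists_reads u v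
  have := hΓ.finite
  -- `K` bounds all the chosen return paths: after `K` further letters, returning to `v` cannot
  -- cancel into `L`.
  obtain ⟨K, hK⟩ := (Set.finite_range fun u => (t u).length).bddAbove
  obtain ⟨M, z, hM, hz, rfl | h⟩ := hΓ.exists_extension L w hL hr K
  · exact ⟨M, hM, hz⟩
  · obtain ⟨N, hN, hred⟩ := exists_red_append L M (t z) hM ((hK ⟨z, rfl⟩).trans h)
    exact ⟨N, hN, Γ.reads_of_red _ _ v v hred ((Γ.reads_append _ _ _ _).2 ⟨z, hz, ht z⟩)⟩

theorem reads_of_subgroupAt_le {Γ : AGraph A V} {Γ' : AGraph A V'} {v : V} {v' : V'}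
    (h : Γ.subgroupAt v ≤ Γ'.subgroupAt v') (L : List (A × Bool)) (hL : IsReduced L)
    (hr : Γ.Reads L v v) : Γ'.Reads L v' v' := by
  classical
  have := (Γ'.mem_subgroupAt_iff v' (FreeGroup.mk L)).1 (h ⟨L, rfl, hr⟩)
  rwa [toWord_mk, hL.reduce_eq] at this

theorem Admissible.exists_reads_of_subgroupAt_le {Γ : AGraph A V} {Γ' : AGraph A V'} {v : V}
    {v' : V'} (hΓ : Γ.Admissible v) (h : Γ.subgroupAt v ≤ Γ'.subgroupAt v')
    (L : List (A × Bool)) (w : V) (hL : IsReduced L) (hr : Γ.Reads L v w) :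
    ∃ w', Γ'.Reads L v' w' := by
  obtain ⟨M, hM, hloop⟩ := hΓ.exists_reduced_loop L w hL hr
  obtain ⟨w', hw', -⟩ := (Γ'.reads_append L M v' v').1 (reads_of_subgroupAt_le h _ hM hloop)
  exact ⟨w', hw'⟩

/-- Two vertices correspond if some word leads to both of them from the base vertices. -/
def Corresp (Γ : AGraph A V) (Γ' : AGraph A V') (v : V) (v' : V') (u : V) (u' : V') : Prop :=
  ∃ L, IsReduced L ∧ Γ.Reads L v u ∧ Γ'.Reads L v' u'

theorem Corresp.symm {Γ : AGraph A V} {Γ' : AGraph A V'} {v u : V} {v' u' : V'}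
    (h : Corresp Γ Γ' v v' u u') : Corresp Γ' Γ v' v u' u :=
  let ⟨L, hL, h1, h2⟩ := h
  ⟨L, hL, h2, h1⟩

theorem Admissible.exists_corresp {Γ : AGraph A V} {Γ' : AGraph A V'} {v : V}
    {v' : V'} (hΓ : Γ.Admissible v) (h : Γ.subgroupAt v ≤ Γ'.subgroupAt v') (u : V) :
    ∃ u', Corresp Γ Γ' v v' u u' := by
  classical
  obtain ⟨L, hL⟩ := hΓ.exists_reads v u
  have hL' := Γ.reads_of_red _ _ _ _ reduce.red hL
  obtain ⟨u', hu'⟩ := hΓ.exists_reads_of_subgroupAt_le h _ _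
    (IsReduced.of_reduce_eq reduce.idem) hL'
  exact ⟨u', _, IsReduced.of_reduce_eq reduce.idem, hL', hu'⟩

/-- The word `L * M⁻¹` is a loop in `Γ`, so its class has a loop `N` in `Γ'`. Then `N ++ M` leads to
`u₂` and reduces to `L`, which leads to `u₁`. -/
theorem Corresp.unique {Γ : AGraph A V} {Γ' : AGraph A V'} {v u : V} {v' u₁ u₂ : V'}
    (h : Γ.subgroupAt v ≤ Γ'.subgroupAt v') (h1 : Corresp Γ Γ' v v' u u₁)
    (h2 : Corresp Γ Γ' v v' u u₂) : u₁ = u₂ := by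
  classical
  obtain ⟨L, hL, hLu, hLu'⟩ := h1
  obtain ⟨M, hM, hMu, hMu'⟩ := h2
  have hmem : FreeGroup.mk (L ++ invRev M) ∈ Γ'.subgroupAt v' :=
    h ⟨_, rfl, (Γ.reads_append _ _ _ _).2 ⟨u, hLu, Γ.reads_invRev _ _ _ hMu⟩⟩
  obtain ⟨N, hN, hNr⟩ := hmem
  have hNM : Γ'.Reads (N ++ M) v' u₂ := (Γ'.reads_append _ _ _ _).2 ⟨v', hNr, hMu'⟩
  have hmk : FreeGroup.mk (N ++ M) = FreeGroup.mk L := by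
    rw [← mul_mk, hN, ← mul_mk, ← inv_mk, inv_mul_cancel_right]
  have hred : reduce (N ++ M) = L := by
    rw [← hL.reduce_eq]
    exact reduce.sound hmk
  have := Γ'.reads_of_red _ _ _ _ reduce.red hNM
  rw [hred] at this
  exact Γ'.reads_unique L v' _ _ hLu' this

theorem Corresp.edge {Γ : AGraph A V} {Γ' : AGraph A V'} {v u w : V} {v' u' w' : V'}
    (hΓ : Γ.Admissible v) (h : Γ.subgroupAt v ≤ Γ'.subgroupAt v') {a : A}
    (hu : Corresp Γ Γ' v v' u u') (hw : Corresp Γ Γ' v v' w w') (he : (u, a, w) ∈ Γ.edges) :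
    (u', a, w') ∈ Γ'.edges := by
  obtain ⟨L, hL, hLu, hLu'⟩ := id hu
  have key : IsReduced (L ++ [(a, true)]) → (u', a, w') ∈ Γ'.edges := by
    intro hred
    have hr : Γ.Reads (L ++ [(a, true)]) v w :=
      (Γ.reads_append _ _ _ _).2 ⟨u, hLu, (Γ.reads_singleton _ _ _).2 he⟩
    obtain ⟨z, hz⟩ := hΓ.exists_reads_of_subgroupAt_le h _ _ hred hr
    have hcz : Corresp Γ Γ' v v' w z := ⟨_, hred, hr, hz⟩
    obtain rfl := hcz.unique h hw
    obtain ⟨y, hy, hyz⟩ := (Γ'.reads_append _ _ _ _).1 hz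
    obtain rfl := Γ'.reads_unique _ _ _ _ hy hLu'
    exact (Γ'.reads_singleton _ _ _).1 hyz
  rcases List.eq_nil_or_concat L with rfl | ⟨K, y, rfl⟩
  · exact key IsReduced.singleton
  rw [List.concat_eq_append] at *
  -- If `L` ends with `a⁻¹`, appending `a` is not reduced, but the last step of `L` has just
  -- traversed the wanted edge backwards.
  by_cases hy : (a, true) = (y.1, !y.2)
  · obtain ⟨c, b⟩ := y
    obtain ⟨rfl, hb⟩ : a = c ∧ true = !b := by simpa using hy
    obtain rfl : b = false := by simpa using hb.symm
    obtain ⟨z, hz, hzu⟩ := (Γ.reads_append _ _ _ _).1 hLu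
    obtain ⟨z', hz', hzu'⟩ := (Γ'.reads_append _ _ _ _).1 hLu'
    rw [reads_singleton] at hzu hzu'
    obtain rfl : z = w := Γ.det _ _ _ _ hzu he
    have hcz : Corresp Γ Γ' v v' z z' := ⟨K, hL.infix ⟨[], [(a, false)], by simp⟩, hz, hz'⟩
    obtain rfl := hcz.unique h hw
    exact hzu'
  · exact key (hL.append_singleton hy)

/-- Admissible graphs representing the same subgroup are isomorphic. -/
theorem Admissible.exists_equiv {Γ : AGraph A V} {Γ' : AGraph A V'} {v : V} {v' : V'}
    (hΓ : Γ.Admissible v) (hΓ' : Γ'.Admissible v') (h : Γ.subgroupAt v = Γ'.subgroupAt v') :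
    ∃ e : V ≃ V', e v = v' ∧ ∀ u a w, (u, a, w) ∈ Γ.edges ↔ (e u, a, e w) ∈ Γ'.edges := by
  choose f hf using fun u => hΓ.exists_corresp h.le u
  choose g hg using fun u => hΓ'.exists_corresp h.ge u
  let e : V ≃ V' :=
    ⟨f, g, fun u => ((hg (f u)).unique h.ge (hf u).symm), fun u => (hf (g u)).unique h.le (hg u).symm⟩
  refine ⟨e, (hf v).unique h.le ⟨[], IsReduced.nil, rfl, rfl⟩, fun u a w => ⟨fun he => ?_, fun he => ?_⟩⟩
  · exact (hf u).edge hΓ h.le (hf w) he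
  · exact (hf u).symm.edge hΓ' h.ge (hf w).symm he

end AGraph

/-! ### Counting partial injections. -/

/-- Partial injections from `α` to `β`, as relations. -/
def PInj (α β : Type*) := {R : α → β → Prop // Relator.BiUnique R}

namespace PInj

variable {α β α' β' : Type*}

instance : CoeFun (PInj α β) fun _ => α → β → Prop := ⟨Subtype.val⟩

theorem left (R : PInj α β) {a a' : α} {b : β} (h : R a b) (h' : R a' b) : a = a' :=
  R.2.1 h h'

theorem right (R : PInj α β) {a : α} {b b' : β} (h : R a b) (h' : R a b') : b = b' :=
  R.2.2 h h'

@[ext]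
theorem ext {R R' : PInj α β} (h : ∀ a b, R a b ↔ R' a b) : R = R' :=
  Subtype.ext (funext fun a => funext fun b => propext (h a b))

instance [Finite α] [Finite β] : Finite (PInj α β) := by
  unfold PInj
  infer_instance

instance : Nonempty (PInj α β) :=
  ⟨⟨fun _ _ => False, fun _ _ _ h => h.elim, fun _ _ _ h => h.elim⟩⟩

/-- Pulling back a partial injection along injections. -/
def comap (R : PInj α β) (f : α' ↪ α) (g : β' ↪ β) : PInj α' β' :=
  ⟨fun a b => R (f a) (g b), fun _ _ _ h h' => f.injective (R.left h h'),
    fun _ _ _ h h' => g.injective (R.right h h')⟩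

/-- Relabelling the two sides of a partial injection. -/
def congr (e : α ≃ α') (e' : β ≃ β') : PInj α β ≃ PInj α' β' where
  toFun R := R.comap e.symm.toEmbedding e'.symm.toEmbedding
  invFun R := R.comap e.toEmbedding e'.toEmbedding
  left_inv R := by ext; simp [comap]
  right_inv R := by ext; simp [comap]

/-- The partial injections that extend a given matching. -/
def extendEquiv {ι : Type*} (s : ι ↪ α) (t : ι ↪ β) :
    {R : PInj α β | ∀ i, R (s i) (t i)} ≃
      PInj ((Set.range s)ᶜ : Set α) ((Set.range t)ᶜ : Set β) where
  toFun R := R.1.comap (Function.Embedding.subtype _) (Function.Embedding.subtype _)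
  invFun R := ⟨⟨fun a b => (∃ i, s i = a ∧ t i = b) ∨ ∃ ha hb, R ⟨a, ha⟩ ⟨b, hb⟩, by
      constructor
      · rintro a a' b (⟨i, rfl, rfl⟩ | ⟨ha, hb, h⟩) (⟨j, rfl, h1⟩ | ⟨ha', hb', h'⟩)
        · rw [t.injective h1]
        · exact absurd ⟨i, rfl⟩ hb'
        · exact absurd ⟨j, h1⟩ hb
        · exact congrArg Subtype.val (R.left h h')
      · rintro a b b' (⟨i, rfl, rfl⟩ | ⟨ha, hb, h⟩) (⟨j, h1, rfl⟩ | ⟨ha', hb', h'⟩)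
        · rw [s.injective h1]
        · exact absurd ⟨i, rfl⟩ ha'
        · exact absurd ⟨j, h1⟩ ha
        · exact congrArg Subtype.val (R.right h h')⟩, fun i => Or.inl ⟨i, rfl, rfl⟩⟩
  left_inv R := by
    obtain ⟨R, hR⟩ := R
    refine Subtype.ext (ext fun a b => ⟨?_, fun h => ?_⟩)
    · rintro (⟨i, rfl, rfl⟩ | ⟨ha, hb, h⟩)
      · exact hR i
      · exact h
    · by_cases ha : a ∈ Set.range s
      · obtain ⟨i, rfl⟩ := ha
        exact Or.inl ⟨i, rfl, R.right (hR i) h⟩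
      · refine Or.inr ⟨ha, ?_, h⟩
        rintro ⟨i, rfl⟩
        exact ha ⟨i, R.left (hR i) h⟩
  right_inv R := by
    ext a b
    constructor
    · rintro (⟨i, h1, h2⟩ | ⟨ha, hb, h⟩)
      · exact absurd ⟨i, h1⟩ a.2
      · exact h
    · exact fun h => Or.inr ⟨a.2, b.2, h⟩

/-- The partial injections between two subsets. -/
def supportedEquiv (S : Set α) (T : Set β) :
    {R : PInj α β | ∀ a b, R a b → a ∈ S ∧ b ∈ T} ≃ PInj S T where
  toFun R := R.1.comap (Function.Embedding.subtype _) (Function.Embedding.subtype _)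
  invFun R := ⟨⟨fun a b => ∃ ha hb, R ⟨a, ha⟩ ⟨b, hb⟩,
      fun _ _ _ ⟨_, _, h⟩ ⟨_, _, h'⟩ => congrArg Subtype.val (R.left h h'),
      fun _ _ _ ⟨_, _, h⟩ ⟨_, _, h'⟩ => congrArg Subtype.val (R.right h h')⟩,
    fun _ _ ⟨ha, hb, _⟩ => ⟨ha, hb⟩⟩
  left_inv R := Subtype.ext <| ext fun a b =>
    ⟨fun ⟨_, _, h⟩ => h, fun h => ⟨(R.2 a b h).1, (R.2 a b h).2, h⟩⟩
  right_inv _ := ext fun a b => ⟨fun ⟨_, _, h⟩ => h, fun h => ⟨a.2, b.2, h⟩⟩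

/-- The number of partial injections of an `n`-element set. -/
noncomputable def count (n : ℕ) : ℕ := Nat.card (PInj (Fin n) (Fin n))

theorem count_pos (n : ℕ) : 0 < count n := Nat.card_pos

theorem card_eq_count [Finite α] [Finite β] {n : ℕ} (hα : Nat.card α = n)
    (hβ : Nat.card β = n) : Nat.card (PInj α β) = count n :=
  Nat.card_congr (congr (Finite.equivFinOfCardEq hα) (Finite.equivFinOfCardEq hβ))

theorem card_compl_range [Finite α] {ι : Type*} (s : ι ↪ α) :
    Nat.card ((Set.range s)ᶜ : Set α) = Nat.card α - Nat.card ι := by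
  rw [Nat.card_coe_set_eq, Set.ncard_compl, ← Nat.card_coe_set_eq,
    Nat.card_range_of_injective s.injective]

theorem ncard_extend {n : ℕ} {ι : Type*} (s t : ι ↪ Fin n) :
    {R : PInj (Fin n) (Fin n) | ∀ i, R (s i) (t i)}.ncard = count (n - Nat.card ι) := by
  rw [← Nat.card_coe_set_eq, Nat.card_congr (extendEquiv s t)]
  exact card_eq_count (by rw [card_compl_range, Nat.card_fin])
    (by rw [card_compl_range, Nat.card_fin])

theorem ncard_apply {n : ℕ} (u v : Fin n) :
    {R : PInj (Fin n) (Fin n) | R u v}.ncard = count (n - 1) := by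
  have h := ncard_extend (ι := Unit) ⟨fun _ => u, fun _ _ _ => rfl⟩ ⟨fun _ => v, fun _ _ _ => rfl⟩
  rw [Nat.card_unique] at h
  rw [← h]
  congr 1
  ext R
  exact ⟨fun hR _ => hR, fun hR => hR ()⟩

/-- Independent of `u` and `v`, even when they coincide; this is what makes the second moment in
`sq_count_sub_le` explicit. -/
theorem ncard_avoid {n : ℕ} (u v : Fin n) :
    {R : PInj (Fin n) (Fin n) | (∀ x, ¬ R u x) ∧ ∀ x, ¬ R x v}.ncard = count (n - 1) := by
  have h : {R : PInj (Fin n) (Fin n) | (∀ x, ¬ R u x) ∧ ∀ x, ¬ R x v} =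
      {R : PInj (Fin n) (Fin n) | ∀ a b, R a b → a ∈ ({u}ᶜ : Set (Fin n)) ∧ b ∈ ({v}ᶜ : Set (Fin n))} := by
    ext R
    constructor
    · rintro ⟨h1, h2⟩ a b h
      exact ⟨fun ha => h1 b (ha ▸ h), fun hb => h2 a (hb ▸ h)⟩
    · exact fun h => ⟨fun x hx => (h u x hx).1 rfl, fun x hx => (h x v hx).2 rfl⟩
  rw [h, ← Nat.card_coe_set_eq, Nat.card_congr (supportedEquiv _ _)]
  refine card_eq_count ?_ ?_ <;>
  rw [Nat.card_coe_set_eq, Set.ncard_compl, Set.ncard_singleton, Nat.card_fin]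

/-- The partial injections that map a set and its complement into themselves. -/
def invariant (S : Set α) : Set (PInj α α) := {R | ∀ a b, R a b → (a ∈ S ↔ b ∈ S)}

/-- An invariant partial injection is determined by its restrictions to `S` and to the complement.
-/
theorem ncard_invariant_le {n : ℕ} (S : Set (Fin n)) :
    (invariant S).ncard ≤ count S.ncard * count (n - S.ncard) := by
  have h1 : Nat.card (PInj S S) = count S.ncard :=
    card_eq_count (Nat.card_coe_set_eq _) (Nat.card_coe_set_eq _)
  have hc : Nat.card (Sᶜ : Set (Fin n)) = n - S.ncard := by
    rw [Nat.card_coe_set_eq, Set.ncard_compl, Nat.card_fin]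
  have h2 : Nat.card (PInj (Sᶜ : Set (Fin n)) (Sᶜ : Set (Fin n))) = count (n - S.ncard) :=
    card_eq_count hc hc
  rw [← h1, ← h2, ← Nat.card_prod, ← Nat.card_coe_set_eq]
  refine Nat.card_le_card_of_injective
    (fun R => (R.1.comap (Function.Embedding.subtype _) (Function.Embedding.subtype _),
      R.1.comap (Function.Embedding.subtype _) (Function.Embedding.subtype _))) ?_
  rintro ⟨R, hR⟩ ⟨R', hR'⟩ h
  have e1 := fun a b => iff_of_eq (congrFun (congrFun (congrArg Subtype.val (congrArg Prod.fst h)) a) b)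
  have e2 := fun a b => iff_of_eq (congrFun (congrFun (congrArg Subtype.val (congrArg Prod.snd h)) a) b)
  refine Subtype.ext (ext fun a b => ?_)
  by_cases ha : a ∈ S <;> by_cases hb : b ∈ S
  · exact e1 ⟨a, ha⟩ ⟨b, hb⟩
  · exact iff_of_false (fun h => hb ((hR a b h).1 ha)) fun h => hb ((hR' a b h).1 ha)
  · exact iff_of_false (fun h => ha ((hR a b h).2 hb)) fun h => ha ((hR' a b h).2 hb)
  · exact e2 ⟨a, ha⟩ ⟨b, hb⟩

end PInj

/-! ### Uniform probability, independence and double counting. -/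

section density

variable {Ω : Type*}

/-- The proportion of the elements of a finite type that belong to a set. -/
noncomputable def density (X : Set Ω) : ℝ := X.ncard / Nat.card Ω

theorem density_nonneg (X : Set Ω) : 0 ≤ density X := by
  unfold density
  positivity

theorem density_univ [Finite Ω] [Nonempty Ω] : density (Set.univ : Set Ω) = 1 := by
  have : (Nat.card Ω : ℝ) ≠ 0 := by exact_mod_cast Nat.card_pos.ne'
  rw [density, Set.ncard_univ, div_self this]

theorem density_mono [Finite Ω] {X Y : Set Ω} (h : X ⊆ Y) : density X ≤ density Y := by
  unfold density
  gcongr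
  exact Y.toFinite

theorem density_union_le (X Y : Set Ω) : density (X ∪ Y) ≤ density X + density Y := by
  rw [density, density, density, ← add_div]
  gcongr
  exact_mod_cast Set.ncard_union_le X Y

theorem density_iUnion_le [Finite Ω] {ι : Type*} [Fintype ι] (X : ι → Set Ω) :
    density (⋃ i, X i) ≤ ∑ i, density (X i) := by
  simp only [density]
  rw [← Finset.sum_div]
  gcongr
  exact_mod_cast Set.ncard_iUnion_le_of_fintype X

/-- Independence of the coordinates of a uniform tuple. -/
theorem density_pi {ι : Type*} [Fintype ι] (X : ι → Set Ω) :
    density {F : ι → Ω | ∀ i, F i ∈ X i} = ∏ i, density (X i) := by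
  simp only [density]
  rw [Finset.prod_div_distrib, Nat.card_pi, ← Nat.card_coe_set_eq]
  have e : {F : ι → Ω | ∀ i, F i ∈ X i} ≃ ∀ i, X i :=
    { toFun F i := ⟨F.1 i, F.2 i⟩
      invFun G := ⟨fun i => G i, fun i => (G i).2⟩
      left_inv _ := rfl
      right_inv _ := rfl }
  rw [Nat.card_congr e, Nat.card_pi]
  simp [Nat.card_coe_set_eq]

theorem density_eval [Finite Ω] [Nonempty Ω] {ι : Type*} [Fintype ι] (i : ι) (X : Set Ω) :
    density {F : ι → Ω | F i ∈ X} = density X := by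
  classical
  have h : {F : ι → Ω | F i ∈ X} = {F | ∀ k, F k ∈ if k = i then X else Set.univ} := by
    ext F
    refine ⟨fun hF k => ?_, fun hF => by simpa using hF i⟩
    split_ifs with hk
    · exact hk ▸ hF
    · trivial
  rw [h, density_pi, Finset.prod_eq_single i]
  · simp
  · intro k _ hk
    rw [if_neg hk, density_univ]
  · simp

theorem density_eval_and [Finite Ω] [Nonempty Ω] {ι : Type*} [Fintype ι] {i j : ι} (hij : i ≠ j)
    (X Y : Set Ω) : density {F : ι → Ω | F i ∈ X ∧ F j ∈ Y} = density X * density Y := by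
  classical
  have h : {F : ι → Ω | F i ∈ X ∧ F j ∈ Y} =
      {F | ∀ k, F k ∈ if k = i then X else if k = j then Y else Set.univ} := by
    ext F
    refine ⟨fun hF k => ?_, fun hF => ⟨by simpa using hF i, by simpa [hij.symm] using hF j⟩⟩
    split_ifs with hk hk'
    · exact hk ▸ hF.1
    · exact hk' ▸ hF.2
    · trivial
  rw [h, density_pi, Finset.prod_eq_mul i j hij]
  · simp [hij.symm]
  · intro k _ hk
    rw [if_neg hk.1, if_neg hk.2, density_univ]
  · simp
  · simp

theorem sum_ncard_comm {ι κ : Type*} [Fintype ι] [Fintype κ] (P : ι → κ → Prop) :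
    ∑ i, {k | P i k}.ncard = ∑ k, {i | P i k}.ncard := by
  classical
  have h1 (i : ι) : {k | P i k}.ncard = ∑ k, if P i k then 1 else 0 := by
    rw [Set.ncard_eq_toFinset_card', Finset.sum_boole]
    simp
  have h2 (k : κ) : {i | P i k}.ncard = ∑ i, if P i k then 1 else 0 := by
    rw [Set.ncard_eq_toFinset_card', Finset.sum_boole]
    simp
  simp only [h1, h2]
  exact Finset.sum_comm

end density

/-! ### A random partial injection is defined almost everywhere. -/

namespace PInj

variable {α β : Type*}

noncomputable instance [Finite α] [Finite β] : Fintype (PInj α β) := Fintype.ofFinite _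

theorem ncard_dom_eq_ncard_ran (R : PInj α β) :
    {u | ∃ x, R u x}.ncard = {v | ∃ x, R x v}.ncard := by
  have h1 : {u | ∃ x, R u x} = Prod.fst '' {p : α × β | R p.1 p.2} := by
    ext u
    simp
  have h2 : {v | ∃ x, R x v} = Prod.snd '' {p : α × β | R p.1 p.2} := by
    ext v
    simp
  rw [h1, h2, Set.InjOn.ncard_image, Set.InjOn.ncard_image]
  · rintro ⟨a, b⟩ h ⟨a', b'⟩ h' (rfl : b = b')
    exact congrArg (·, b) (R.left h h')
  · rintro ⟨a, b⟩ h ⟨a', b'⟩ h' (rfl : a = a')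
    exact congrArg (a, ·) (R.right h h')

variable {n : ℕ}

theorem card_eq : Nat.card (PInj (Fin n) (Fin n)) = count n := rfl

theorem ncard_source_mem (u : Fin n) :
    {R : PInj (Fin n) (Fin n) | ∃ v, R u v}.ncard = n * count (n - 1) := by
  classical
  have h := sum_ncard_comm fun (R : PInj (Fin n) (Fin n)) v => R u v
  have h1 (R : PInj (Fin n) (Fin n)) : {v | R u v}.ncard = if ∃ v, R u v then 1 else 0 := by
    split_ifs with h
    · obtain ⟨v, hv⟩ := h
      rw [Set.ncard_eq_one]
      exact ⟨v, Set.eq_singleton_iff_unique_mem.2 ⟨hv, fun w hw => R.right hw hv⟩⟩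
    · rw [Set.ncard_eq_zero]
      exact Set.eq_empty_of_forall_notMem fun v hv => h ⟨v, hv⟩
  simp only [h1, ncard_apply, Finset.sum_boole, Finset.sum_const, Finset.card_univ,
    Fintype.card_fin, smul_eq_mul, Nat.cast_id] at h
  rw [← h, Set.ncard_eq_toFinset_card']
  simp

theorem ncard_source_notMem (u : Fin n) :
    ({R : PInj (Fin n) (Fin n) | ∀ v, ¬ R u v}.ncard : ℝ) = count n - n * count (n - 1) := by
  have h := Set.ncard_add_ncard_compl {R : PInj (Fin n) (Fin n) | ∃ v, R u v}
  rw [ncard_source_mem, card_eq] at h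
  have h2 : {R : PInj (Fin n) (Fin n) | ∃ v, R u v}ᶜ = {R | ∀ v, ¬ R u v} := by
    ext R
    simp
  rw [h2] at h
  rw [← h]
  push_cast
  ring

/-- The inverse partial injection. -/
def inv (R : PInj α β) : PInj β α := ⟨fun b a => R a b, fun _ _ _ h h' => R.right h h',
  fun _ _ _ h h' => R.left h h'⟩

/-- Inversion as an equivalence. -/
def invEquiv : PInj α β ≃ PInj β α := ⟨inv, inv, fun _ => rfl, fun _ => rfl⟩

theorem ncard_target_notMem (v : Fin n) :
    ({R : PInj (Fin n) (Fin n) | ∀ u, ¬ R u v}.ncard : ℝ) = count n - n * count (n - 1) := by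
  rw [← ncard_source_notMem v, ← Set.ncard_image_of_injective _ invEquiv.injective]
  congr 2
  ext R
  exact ⟨fun ⟨S, hS, h⟩ => h ▸ hS, fun h => ⟨inv R, h, rfl⟩⟩

theorem mul_count_pred_le (hn : 0 < n) : n * count (n - 1) ≤ count n := by
  have : (0 : ℝ) ≤ count n - n * count (n - 1) := by
    rw [← ncard_source_notMem (⟨0, hn⟩ : Fin n)]
    positivity
  exact_mod_cast sub_nonneg.1 this

/-- As many points lie outside the domain of `R` as outside its range. Writing `D R` for this
number, `D R ^ 2` counts pairs of a point outside the domain and a point outside the range, so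
`ncard_avoid` gives its sum over `R`. Cauchy–Schwarz compares it with the sum of `D`. -/
theorem sq_count_sub_le (hn : 0 < n) :
    ((count n : ℝ) - n * count (n - 1)) ^ 2 ≤ count n * count (n - 1) := by
  let D (R : PInj (Fin n) (Fin n)) : ℝ := {u | ∀ x, ¬ R u x}.ncard
  have hD (R : PInj (Fin n) (Fin n)) : D R = {v | ∀ x, ¬ R x v}.ncard := by
    have h1 := Set.ncard_add_ncard_compl {u | ∃ x, R u x}
    have h2 := Set.ncard_add_ncard_compl {v | ∃ x, R x v}
    rw [ncard_dom_eq_ncard_ran] at h1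
    simp only [Set.compl_ofPred, not_exists] at h1 h2
    simp only [D]
    exact_mod_cast (by omega)
  have hsum : ∑ R, D R = n * ((count n : ℝ) - n * count (n - 1)) := by
    simp only [D]
    rw [← Nat.cast_sum, sum_ncard_comm fun (R : PInj (Fin n) (Fin n)) u => ∀ x, ¬ R u x]
    push_cast
    simp only [ncard_source_notMem, Finset.sum_const, Finset.card_univ, Fintype.card_fin,
      nsmul_eq_mul]
  have hsq : ∑ R, D R ^ 2 = n ^ 2 * count (n - 1) := by
    have (R : PInj (Fin n) (Fin n)) : D R ^ 2 =
        {p : Fin n × Fin n | (∀ x, ¬ R p.1 x) ∧ ∀ x, ¬ R x p.2}.ncard := by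
      rw [sq]
      nth_rewrite 2 [hD]
      simp only [D]
      rw [← Nat.cast_mul, ← Set.ncard_prod]
      rfl
    simp only [this]
    rw [← Nat.cast_sum,
      sum_ncard_comm fun (R : PInj (Fin n) (Fin n)) (p : Fin n × Fin n) =>
        (∀ x, ¬ R p.1 x) ∧ ∀ x, ¬ R x p.2]
    simp only [ncard_avoid]
    simp [sq]
  have hcs := sq_sum_le_card_mul_sum_sq (s := Finset.univ) (f := D)
  rw [hsum, hsq, Finset.card_univ, ← Nat.card_eq_fintype_card, card_eq] at hcs
  have hn' : (0 : ℝ) < (n : ℝ) ^ 2 := by positivity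
  refine le_of_mul_le_mul_left ?_ hn'
  linarith

/-- The probability that a random partial injection is defined at a given point. -/
noncomputable def ratio (n : ℕ) : ℝ := n * count (n - 1) / count n

theorem ratio_le_one (n : ℕ) : ratio n ≤ 1 := by
  rcases Nat.eq_zero_or_pos n with rfl | hn
  · simp [ratio]
  · exact div_le_one_of_le₀ (by exact_mod_cast mul_count_pred_le hn) (by positivity)

/-- By `sq_count_sub_le`, the square of the left side is at most `count (n - 1) / count n`, hence at
most `1 / n`. -/
theorem one_sub_ratio_le (hn : 0 < n) : 1 - ratio n ≤ 1 / √n := by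
  have hc : (0 : ℝ) < count n := by exact_mod_cast count_pos n
  have hn' : (0 : ℝ) < n := by exact_mod_cast hn
  have h1 : (n : ℝ) * count (n - 1) ≤ count n := by exact_mod_cast mul_count_pred_le hn
  have h2 := sq_count_sub_le hn
  have h3 : 1 - ratio n = (count n - n * count (n - 1)) / count n := by
    unfold ratio
    field_simp
  rw [h3]
  refine le_of_sq_le_sq ?_ (by positivity)
  rw [div_pow, div_pow, Real.sq_sqrt hn'.le, one_pow, div_le_div_iff₀ (by positivity) hn']
  nlinarith

theorem tendsto_ratio : Filter.Tendsto ratio Filter.atTop (nhds 1) := by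
  have h : Filter.Tendsto (fun n : ℕ => 1 - 1 / √(n : ℝ)) Filter.atTop (nhds (1 - 0)) := by
    refine tendsto_const_nhds.sub ?_
    simp only [one_div]
    exact tendsto_inv_atTop_zero.comp (Real.tendsto_sqrt_atTop.comp tendsto_natCast_atTop_atTop)
  rw [sub_zero] at h
  refine tendsto_of_tendsto_of_tendsto_of_le_of_le' h tendsto_const_nhds ?_
    (Filter.Eventually.of_forall ratio_le_one)
  filter_upwards [Filter.eventually_gt_atTop 0] with n hn
  linarith [one_sub_ratio_le hn]

theorem density_source_notMem (u : Fin n) :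
    density {R : PInj (Fin n) (Fin n) | ∀ v, ¬ R u v} = 1 - ratio n := by
  have hc : (count n : ℝ) ≠ 0 := by exact_mod_cast (count_pos n).ne'
  rw [density, ncard_source_notMem, card_eq, ratio]
  field_simp

theorem density_target_notMem (v : Fin n) :
    density {R : PInj (Fin n) (Fin n) | ∀ u, ¬ R u v} = 1 - ratio n := by
  rw [← density_source_notMem v, density, density, ncard_source_notMem, ncard_target_notMem]

theorem density_isolated (v : Fin n) :
    density {R : PInj (Fin n) (Fin n) | (∀ x, ¬ R v x) ∧ ∀ x, ¬ R x v} = ratio n / n := by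
  have hn : (n : ℝ) ≠ 0 := by exact_mod_cast (Fin.pos v).ne'
  rw [density, ncard_avoid, card_eq, ratio]
  field_simp

end PInj

/-! ### Union bound and binomial estimates. -/

theorem density_biUnion_le {Ω ι : Type*} [Finite Ω] (s : Finset ι) (X : ι → Set Ω) :
    density (⋃ i ∈ s, X i) ≤ ∑ i ∈ s, density (X i) := by
  classical
  induction s using Finset.induction_on with
  | empty => simp [density]
  | insert i s hi ih =>
    rw [Finset.set_biUnion_insert, Finset.sum_insert hi]
    exact (density_union_le _ _).trans (by gcongr)

theorem Nat.two_pow_le_choose (n k : ℕ) (h : 2 * k ≤ n) : 2 ^ k ≤ n.choose k := by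
  induction k generalizing n with
  | zero => simp
  | succ k ih =>
    obtain ⟨m, rfl⟩ : ∃ m, n = m + 1 := ⟨n - 1, by omega⟩
    have h1 := ih m (by omega)
    have h2 := Nat.add_one_mul_choose_eq m k
    have h3 : 2 * (k + 1) * 2 ^ k ≤ (m + 1) * m.choose k := Nat.mul_le_mul h h1
    rw [h2, mul_comm, mul_comm ((m + 1).choose _), mul_comm 2, mul_comm (2 ^ k), mul_assoc,
      ← pow_succ'] at h3
    exact Nat.le_of_mul_le_mul_left h3 (by omega)

/-- The factor `n / (2 * k)` gained over `2 ^ k ≤ n.choose k` produces the decay in `1 / n` of the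
union bound over invariant sets. -/
theorem Nat.mul_two_pow_le_mul_choose (n k : ℕ) (h : 2 * k ≤ n) :
    n * 2 ^ k ≤ 2 * k * n.choose k ∨ k = 0 := by
  rcases k with _ | k
  · exact Or.inr rfl
  left
  obtain ⟨m, rfl⟩ : ∃ m, n = m + 1 := ⟨n - 1, by omega⟩
  have h1 := Nat.two_pow_le_choose m k (by omega)
  have h2 := Nat.add_one_mul_choose_eq m k
  calc (m + 1) * 2 ^ (k + 1) = 2 * ((m + 1) * 2 ^ k) := by ring
    _ ≤ 2 * ((m + 1) * m.choose k) := by gcongr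
    _ = 2 * (k + 1) * (m + 1).choose (k + 1) := by rw [h2]; ring

/-! ### Small invariant sets are unlikely. -/

namespace PInj

open Filter

variable {n : ℕ}

theorem descFactorial_mul_count_le (n k : ℕ) : n.descFactorial k * count (n - k) ≤ count n := by
  induction k with
  | zero => simp
  | succ k ih =>
    refine le_trans ?_ ih
    rcases Nat.eq_zero_or_pos (n - k) with h | h
    · simp [Nat.descFactorial_succ, h]
    · rw [Nat.descFactorial_succ, mul_comm (n - k), mul_assoc, Nat.sub_add_eq]
      exact Nat.mul_le_mul_left _ (mul_count_pred_le h)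

/-- The number of partial injections grows barely faster than the factorial. -/
theorem exists_count_le : ∃ K : ℝ, 0 < K ∧ ∀ k, (count k : ℝ) ≤ K * (5 / 4) ^ k * k.factorial := by
  -- The threshold `4 / 5` gives growth rate `5 / 4`, whose square is less than `2`; this is all
  -- that the union bound needs.
  obtain ⟨N, hN⟩ := eventually_atTop.1 (tendsto_ratio.eventually
    (eventually_ge_nhds (show (4 / 5 : ℝ) < 1 by norm_num)))
  let K : ℝ := ∑ k ∈ Finset.range (N + 1), (count k : ℝ)
  have hK (k : ℕ) (hk : k ≤ N) : (count k : ℝ) ≤ K :=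
    Finset.single_le_sum (f := fun k => (count k : ℝ)) (fun _ _ => by positivity)
      (Finset.mem_range.2 (by omega))
  have hK0 : 0 < K := lt_of_lt_of_le (by exact_mod_cast count_pos 0) (hK 0 (Nat.zero_le _))
  refine ⟨K, hK0, fun k => ?_⟩
  induction k with
  | zero => simpa using hK 0 (Nat.zero_le _)
  | succ k ih =>
    by_cases hk : k + 1 ≤ N
    · refine (hK _ hk).trans ?_
      rw [mul_assoc]
      refine le_mul_of_one_le_right hK0.le ?_
      have h1 : (1 : ℝ) ≤ (5 / 4) ^ (k + 1) := one_le_pow₀ (by norm_num)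
      have h2 : (1 : ℝ) ≤ (k + 1).factorial := by exact_mod_cast Nat.factorial_pos _
      nlinarith
    · have h1 : 4 / 5 ≤ ratio (k + 1) := hN (k + 1) (by omega)
      have hc : (0 : ℝ) < count (k + 1) := by exact_mod_cast count_pos _
      rw [ratio, le_div_iff₀ hc, Nat.add_sub_cancel] at h1
      have h2 : (count (k + 1) : ℝ) ≤ 5 / 4 * (((k + 1 : ℕ) : ℝ) * count k) := by linarith
      refine h2.trans ?_
      rw [Nat.factorial_succ, Nat.cast_mul]
      calc 5 / 4 * (((k + 1 : ℕ) : ℝ) * count k)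
          ≤ 5 / 4 * (((k + 1 : ℕ) : ℝ) * (K * (5 / 4) ^ k * k.factorial)) := by gcongr
        _ = _ := by ring

theorem density_invariant_le (S : Set (Fin n)) :
    density (invariant S) ≤ count S.ncard / (S.ncard.factorial * n.choose S.ncard) := by
  have hS : S.ncard ≤ n := by simpa using Set.ncard_le_card S
  have hc : (0 : ℝ) < count n := by exact_mod_cast count_pos n
  have hch : (0 : ℝ) < n.choose S.ncard := by exact_mod_cast Nat.choose_pos hS
  have h1 : ((invariant S).ncard : ℝ) ≤ count S.ncard * count (n - S.ncard) := by
    exact_mod_cast ncard_invariant_le S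
  have h2 : ((S.ncard.factorial : ℝ) * n.choose S.ncard) * count (n - S.ncard) ≤ count n := by
    have := descFactorial_mul_count_le n S.ncard
    rw [Nat.descFactorial_eq_factorial_mul_choose] at this
    exact_mod_cast this
  rw [density, card_eq, div_le_div_iff₀ hc (by positivity)]
  calc ((invariant S).ncard : ℝ) * (S.ncard.factorial * n.choose S.ncard)
      ≤ count S.ncard * count (n - S.ncard) * (S.ncard.factorial * n.choose S.ncard) := by gcongr
    _ = count S.ncard * (((S.ncard.factorial : ℝ) * n.choose S.ncard) * count (n - S.ncard)) := by
        ring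
    _ ≤ _ := by gcongr

/-- A tuple of at least two random partial injections has no small invariant set, with
probability tending to `1`. -/
theorem exists_density_invariant_le : ∃ K : ℝ, ∀ (A : Type*) [Finite A] (a b : A), a ≠ b →
    ∀ n : ℕ, density {F : A → PInj (Fin n) (Fin n) |
      ∃ S : Set (Fin n), S.Nonempty ∧ 2 * S.ncard ≤ n ∧ ∀ c, F c ∈ invariant S} ≤ K / n := by
  classical
  obtain ⟨K, hK0, hK⟩ := exists_count_le
  have hsum : Summable fun k : ℕ => (k : ℝ) * (25 / 32 : ℝ) ^ k := by
    simpa using summable_pow_mul_geometric_of_norm_lt_one 1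
      (show ‖(25 / 32 : ℝ)‖ < 1 by norm_num)
  refine ⟨2 * K ^ 2 * ∑' k : ℕ, (k : ℝ) * (25 / 32 : ℝ) ^ k, fun A _ a b hab n => ?_⟩
  have := Fintype.ofFinite A
  rcases Nat.eq_zero_or_pos n with rfl | hn
  · rw [Nat.cast_zero, div_zero]
    refine (le_of_eq ?_)
    rw [density, Set.ncard_eq_zero (Set.toFinite _) |>.2, Nat.cast_zero, zero_div]
    refine Set.eq_empty_of_forall_notMem ?_
    rintro F ⟨S, ⟨x, -⟩, -⟩
    exact x.elim0
  have hn' : (0 : ℝ) < n := by exact_mod_cast hn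
  let g (k : ℕ) : ℝ :=
    if 0 < k ∧ 2 * k ≤ n then (count k / (k.factorial * n.choose k)) ^ 2 else 0
  have hsub : {F : A → PInj (Fin n) (Fin n) |
      ∃ S : Set (Fin n), S.Nonempty ∧ 2 * S.ncard ≤ n ∧ ∀ c, F c ∈ invariant S} ⊆
      ⋃ S ∈ (Finset.univ : Finset (Fin n)).powerset,
        {F | 0 < S.card ∧ 2 * S.card ≤ n ∧ F a ∈ invariant (S : Set (Fin n)) ∧
          F b ∈ invariant (S : Set (Fin n))} := by
    rintro F ⟨S, hS, hS2, hF⟩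
    refine Set.mem_biUnion (x := S.toFinset) (by simp) ?_
    have hcard : S.toFinset.card = S.ncard := (Set.ncard_eq_toFinset_card' S).symm
    refine ⟨?_, ?_, ?_, ?_⟩
    · rw [hcard, Set.ncard_pos]
      exact hS
    · rwa [hcard]
    · simpa using hF a
    · simpa using hF b
  have hS (S : Finset (Fin n)) :
      density {F : A → PInj (Fin n) (Fin n) | 0 < S.card ∧ 2 * S.card ≤ n ∧
        F a ∈ invariant (S : Set (Fin n)) ∧ F b ∈ invariant (S : Set (Fin n))} ≤ g S.card := by
    simp only [g]
    split_ifs with h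
    · refine (density_mono (Y := {F | F a ∈ invariant (S : Set (Fin n)) ∧
        F b ∈ invariant (S : Set (Fin n))}) fun F hF => hF.2.2).trans ?_
      rw [density_eval_and hab, ← sq]
      have := density_invariant_le (S : Set (Fin n))
      rw [Set.ncard_coe_finset] at this
      exact pow_le_pow_left₀ (density_nonneg _) this 2
    · refine le_of_eq ?_
      rw [density, Set.ncard_eq_zero (Set.toFinite _) |>.2, Nat.cast_zero, zero_div]
      exact Set.eq_empty_of_forall_notMem fun F hF => h ⟨hF.1, hF.2.1⟩
  -- Two independent letters give a square, so one factor `1 / n.choose k` survives the sum over the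
  -- sets of size `k` and beats `(25 / 16) ^ k`; the rate is `25 / 32 = (25 / 16) / 2`.
  have hg (k : ℕ) : n.choose k * g k ≤ 2 * K ^ 2 / n * ((k : ℝ) * (25 / 32 : ℝ) ^ k) := by
    simp only [g]
    split_ifs with h
    · have hch : (0 : ℝ) < n.choose k := by exact_mod_cast Nat.choose_pos (by omega)
      have hfac : (0 : ℝ) < k.factorial := by exact_mod_cast k.factorial_pos
      have h1 : (count k : ℝ) / (k.factorial * n.choose k) ≤ K * (5 / 4) ^ k / n.choose k := by
        rw [div_le_div_iff₀ (by positivity) hch]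
        calc (count k : ℝ) * n.choose k ≤ K * (5 / 4) ^ k * k.factorial * n.choose k := by
              gcongr
              exact hK k
          _ = _ := by ring
      have h2 : (n : ℝ) * 2 ^ k ≤ 2 * k * n.choose k := by
        exact_mod_cast (Nat.mul_two_pow_le_mul_choose n k h.2).resolve_right (by omega)
      calc (n.choose k : ℝ) * (count k / (k.factorial * n.choose k)) ^ 2
          ≤ n.choose k * (K * (5 / 4) ^ k / n.choose k) ^ 2 := by gcongr
        _ = K ^ 2 * (25 / 16) ^ k / n.choose k := by
            have : (25 / 16 : ℝ) = (5 / 4) ^ 2 := by norm_num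
            rw [this, ← pow_mul, mul_comm 2 k, pow_mul]
            field_simp
        _ ≤ 2 * K ^ 2 / n * ((k : ℝ) * (25 / 32 : ℝ) ^ k) := by
            have h3 : (25 / 32 : ℝ) ^ k = (25 / 16) ^ k / 2 ^ k := by
              rw [← div_pow]
              norm_num
            rw [h3, div_le_iff₀ hch]
            have h4 : 2 * K ^ 2 / n * ((k : ℝ) * ((25 / 16) ^ k / 2 ^ k)) * n.choose k =
              K ^ 2 * (25 / 16) ^ k * ((2 * k * n.choose k) / (n * 2 ^ k)) := by
              field_simp
            rw [h4]
            refine le_mul_of_one_le_right (by positivity) ?_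
            rwa [one_le_div₀ (by positivity)]
    · rw [mul_zero]
      positivity
  calc density _ ≤ ∑ S ∈ (Finset.univ : Finset (Fin n)).powerset, g S.card :=
        (density_mono hsub).trans ((density_biUnion_le _ _).trans
          (Finset.sum_le_sum fun S _ => hS S))
    _ = ∑ k ∈ Finset.range (n + 1), n.choose k * g k := by
        rw [Finset.sum_powerset_apply_card]
        simp
    _ ≤ ∑ k ∈ Finset.range (n + 1), 2 * K ^ 2 / n * ((k : ℝ) * (25 / 32 : ℝ) ^ k) :=
        Finset.sum_le_sum fun k _ => hg k
    _ = 2 * K ^ 2 / n * ∑ k ∈ Finset.range (n + 1), (k : ℝ) * (25 / 32 : ℝ) ^ k := by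
        rw [Finset.mul_sum]
    _ ≤ 2 * K ^ 2 / n * ∑' k : ℕ, (k : ℝ) * (25 / 32 : ℝ) ^ k := by
        gcongr
        exact hsum.sum_le_tsum _ fun _ _ => by positivity
    _ = _ := by ring

end PInj

/-! ### Random `A`-graphs: connectedness and leaves. -/

namespace AGraph

variable {A V : Type*}

/-- The `A`-graph given by a family of partial injections. -/
def ofPInj (F : A → PInj V V) : AGraph A V where
  edges := {e | F e.2.1 e.1 e.2.2}
  det _ a _ _ h h' := (F a).right h h'
  codet _ _ a _ h h' := (F a).left h h'

/-- An `A`-graph is a family of partial injections. -/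
def equivPInj : AGraph A V ≃ (A → PInj V V) where
  toFun Γ a := ⟨fun u v => (u, a, v) ∈ Γ.edges, fun _ _ _ h h' => Γ.codet _ _ _ _ h h',
    fun _ _ _ h h' => Γ.det _ _ _ _ h h'⟩
  invFun := ofPInj
  left_inv _ := rfl
  right_inv _ := rfl

/-- A component and its complement are both invariant, and one of them has at most half of the
vertices. -/
theorem exists_invariant_of_not_connected {n : ℕ} (hn : 0 < n) (F : A → PInj (Fin n) (Fin n))
    (h : ¬ (ofPInj F).toSimpleGraph.Connected) :
    ∃ S : Set (Fin n), S.Nonempty ∧ 2 * S.ncard ≤ n ∧ ∀ c, F c ∈ PInj.invariant S := by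
  have hne : Nonempty (Fin n) := ⟨⟨0, hn⟩⟩
  have hpre : ¬ (ofPInj F).toSimpleGraph.Preconnected := fun hp => h ⟨hp⟩
  simp only [SimpleGraph.Preconnected, not_forall] at hpre
  obtain ⟨u, v, huv⟩ := hpre
  let S : Set (Fin n) := {w | (ofPInj F).toSimpleGraph.Reachable u w}
  have hS (c : A) : F c ∈ PInj.invariant S := by
    intro x y hxy
    have hr : (ofPInj F).toSimpleGraph.Reachable x y := by
      by_cases hne : x = y
      · rw [hne]
      · refine SimpleGraph.Adj.reachable ?_
        rw [toSimpleGraph, SimpleGraph.fromRel_adj]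
        exact ⟨hne, Or.inl ⟨c, hxy⟩⟩
    exact ⟨fun hx => SimpleGraph.Reachable.trans hx hr,
      fun hy => SimpleGraph.Reachable.trans hy hr.symm⟩
  have hcard : S.ncard + Sᶜ.ncard = n := by
    rw [Set.ncard_add_ncard_compl, Nat.card_fin]
  by_cases h2 : 2 * S.ncard ≤ n
  · exact ⟨S, ⟨u, SimpleGraph.Reachable.refl u⟩, h2, hS⟩
  · exact ⟨Sᶜ, ⟨v, huv⟩, by omega, fun c x y hxy => not_congr (hS c x y hxy)⟩

theorem IsLeaf.isolated_or {F : A → PInj V V} {v : V} (h : (ofPInj F).IsLeaf v) {a b : A}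
    (hab : a ≠ b) :
    (((∀ x, ¬ F a v x) ∧ ∀ x, ¬ F a x v) ∧ ((∀ x, ¬ F b v x) ∨ ∀ x, ¬ F b x v)) ∨
    (((∀ x, ¬ F b v x) ∧ ∀ x, ¬ F b x v) ∧ ((∀ x, ¬ F a v x) ∨ ∀ x, ¬ F a x v)) := by
  unfold IsLeaf degree at h
  have h1 : {p : A × V | (v, p.1, p.2) ∈ (ofPInj F).edges}.Subsingleton :=
    Set.encard_le_one_iff_subsingleton.1 (le_self_add.trans h)
  have h2 : {p : V × A | (p.1, p.2, v) ∈ (ofPInj F).edges}.Subsingleton :=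
    Set.encard_le_one_iff_subsingleton.1 (le_add_self.trans h)
  have h3 (c d : A) (x y : V) (hx : F c v x) (hy : F d y v) : False := by
    have e1 : 1 ≤ {p : A × V | (v, p.1, p.2) ∈ (ofPInj F).edges}.encard :=
      Set.one_le_encard_iff_nonempty.2 ⟨(c, x), hx⟩
    have e2 : 1 ≤ {p : V × A | (p.1, p.2, v) ∈ (ofPInj F).edges}.encard :=
      Set.one_le_encard_iff_nonempty.2 ⟨(y, d), hy⟩
    have := (add_le_add e1 e2).trans h
    norm_num at this
  have h4 (x y : V) (hx : F a v x) (hy : F b v y) : False :=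
    hab (congrArg Prod.fst (h1 (show (a, x) ∈ _ from hx) (show (b, y) ∈ _ from hy)))
  have h5 (x y : V) (hx : F a x v) (hy : F b y v) : False :=
    hab (congrArg Prod.snd (h2 (show (x, a) ∈ _ from hx) (show (y, b) ∈ _ from hy)))
  by_cases ha : (∃ x, F a v x) <;> by_cases ha' : (∃ x, F a x v) <;>
    by_cases hb : (∃ x, F b v x) <;> by_cases hb' : (∃ x, F b x v) <;> grind

/-- At a leaf, one of `a`, `b` is absent, with probability at most `1 / n`, and independently the
other lacks an incoming or outgoing edge, with probability at most `2 * (1 - ratio n)`. The factor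
`1 / n` pays for the union over the vertices. -/
theorem density_leaf_le [Finite A] {a b : A} (hab : a ≠ b) (n : ℕ) :
    density {F : A → PInj (Fin n) (Fin n) | ∃ v, (ofPInj F).IsLeaf v} ≤
      4 * (1 - PInj.ratio n) := by
  have := Fintype.ofFinite A
  have hr := PInj.ratio_le_one n
  have hsub : {F : A → PInj (Fin n) (Fin n) | ∃ v, (ofPInj F).IsLeaf v} ⊆
      ⋃ v, {F | (ofPInj F).IsLeaf v} := by
    rintro F ⟨v, hv⟩
    exact Set.mem_iUnion.2 ⟨v, hv⟩
  have hv (v : Fin n) : density {F : A → PInj (Fin n) (Fin n) | (ofPInj F).IsLeaf v} ≤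
      4 * (1 - PInj.ratio n) / n := by
    have hn : (0 : ℝ) < n := by exact_mod_cast Fin.pos v
    have key {a b : A} (hab : a ≠ b) : density {F : A → PInj (Fin n) (Fin n) |
        (((∀ x, ¬ F a v x) ∧ ∀ x, ¬ F a x v) ∧ ((∀ x, ¬ F b v x) ∨ ∀ x, ¬ F b x v))} ≤
        2 * (1 - PInj.ratio n) / n := by
      refine (density_eval_and hab {R : PInj (Fin n) (Fin n) | (∀ x, ¬ R v x) ∧ ∀ x, ¬ R x v}
        ({R | ∀ x, ¬ R v x} ∪ {R | ∀ x, ¬ R x v})).le.trans ?_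
      rw [PInj.density_isolated]
      have h1 := density_union_le {R : PInj (Fin n) (Fin n) | ∀ x, ¬ R v x} {R | ∀ x, ¬ R x v}
      rw [PInj.density_source_notMem, PInj.density_target_notMem] at h1
      calc PInj.ratio n / n * density _ ≤ 1 / n * (1 - PInj.ratio n + (1 - PInj.ratio n)) := by
            gcongr
            exact density_nonneg _
        _ = _ := by ring
    refine (density_mono (Y := _ ∪ _) fun F hF => IsLeaf.isolated_or hF hab).trans
      ((density_union_le _ _).trans ((add_le_add (key hab) (key hab.symm)).trans (le_of_eq ?_)))
    ring
  rcases Nat.eq_zero_or_pos n with rfl | hn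
  · refine le_trans (le_of_eq ?_) (mul_nonneg zero_le_four (sub_nonneg.2 hr))
    rw [density, Set.ncard_eq_zero (Set.toFinite _) |>.2, Nat.cast_zero, zero_div]
    exact Set.eq_empty_of_forall_notMem fun F ⟨v, _⟩ => v.elim0
  · refine (density_mono hsub).trans ((density_iUnion_le _).trans
      ((Finset.sum_le_sum fun v _ => hv v).trans (le_of_eq ?_)))
    rw [Finset.sum_const, Finset.card_univ, Fintype.card_fin, nsmul_eq_mul]
    field_simp

end AGraph

/-! ### Cycles of random partial injections: the second moment method. -/

namespace PInj

open Filter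

variable {n : ℕ} {α I J : Type*}

/-- The embeddings of `I` along which a partial injection acts as the permutation `π`. -/
def copies (π : Equiv.Perm I) (R : PInj α α) : Set (I ↪ α) := {s | ∀ i, R (s i) (s (π i))}

/-- The average number of embeddings of `k` points along which a random partial injection acts as
a given permutation. -/
noncomputable def meanCopies (n k : ℕ) : ℝ := n.descFactorial k * count (n - k) / count n

theorem meanCopies_le_one (n k : ℕ) : meanCopies n k ≤ 1 :=
  div_le_one_of_le₀ (by exact_mod_cast descFactorial_mul_count_le n k) (by positivity)

theorem meanCopies_succ (n k : ℕ) : meanCopies n (k + 1) = meanCopies n k * ratio (n - k) := by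
  have hc : (count (n - k) : ℝ) ≠ 0 := by exact_mod_cast (count_pos _).ne'
  rw [meanCopies, meanCopies, ratio, Nat.descFactorial_succ, Nat.sub_add_eq]
  push_cast
  field_simp

theorem tendsto_meanCopies (k : ℕ) : Tendsto (fun n => meanCopies n k) atTop (nhds 1) := by
  induction k with
  | zero =>
    refine tendsto_const_nhds.congr fun n => ?_
    have hc : (count n : ℝ) ≠ 0 := by exact_mod_cast (count_pos _).ne'
    simp [meanCopies, hc]
  | succ k ih =>
    simp only [meanCopies_succ]
    simpa using ih.mul (tendsto_ratio.comp (tendsto_sub_atTop_nat k))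

/-- By `ncard_extend`, every embedding is a copy for the same number of `R`, whatever `π` is. -/
theorem sum_ncard_copies [Fintype I] (π : Equiv.Perm I) :
    ∑ R : PInj (Fin n) (Fin n), ((copies π R).ncard : ℝ) =
      count n * meanCopies n (Fintype.card I) := by
  classical
  have hc : (count n : ℝ) ≠ 0 := by exact_mod_cast (count_pos n).ne'
  unfold copies
  rw [← Nat.cast_sum, sum_ncard_comm fun (R : PInj (Fin n) (Fin n)) (s : I ↪ Fin n) =>
    ∀ i, R (s i) (s (π i))]
  have h (s : I ↪ Fin n) : {R : PInj (Fin n) (Fin n) | ∀ i, R (s i) (s (π i))}.ncard =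
      count (n - Fintype.card I) := by
    rw [← Nat.card_eq_fintype_card]
    exact ncard_extend s (π.toEmbedding.trans s)
  simp only [h, Finset.sum_const, Finset.card_univ, Fintype.card_embedding_eq, Fintype.card_fin,
    smul_eq_mul, meanCopies]
  push_cast
  field_simp

/-- Two disjoint copies glue to a copy of the sum permutation, so a mixed second moment reduces to a
first moment. -/
theorem ncard_disjoint_copies_le [Finite α] [Finite I] [Finite J] (π : Equiv.Perm I)
    (τ : Equiv.Perm J) (R : PInj α α) :
    {p : (I ↪ α) × (J ↪ α) | p.1 ∈ copies π R ∧ p.2 ∈ copies τ R ∧ ∀ i j, p.1 i ≠ p.2 j}.ncard ≤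
      (copies (Equiv.sumCongr π τ) R).ncard := by
  refine (Set.ncard_le_ncard (t := (fun s : I ⊕ J ↪ α =>
    (Function.Embedding.inl.trans s, Function.Embedding.inr.trans s)) ''
      copies (Equiv.sumCongr π τ) R) ?_).trans (Set.ncard_image_le)
  rintro ⟨s, t⟩ ⟨hs, ht, hst⟩
  refine ⟨⟨Sum.elim s t, s.injective.sumElim t.injective hst⟩, ?_, ?_⟩
  · rintro (i | j)
    · exact hs i
    · exact ht j
  · rfl

/-- The cycles of length `l` of a partial injection, with a base point. -/
abbrev cycles (l : ℕ) (R : PInj α α) : Set (ZMod l ↪ α) := copies (Equiv.addRight (1 : ZMod l)) R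

theorem cycles_apply_add {l : ℕ} {R : PInj α α} {s : ZMod l ↪ α} (hs : s ∈ cycles l R)
    {m : ℕ} {t : ZMod m ↪ α} (ht : t ∈ cycles m R) {i : ZMod l} {j : ZMod m} (h : s i = t j)
    (k : ℕ) : s (i + k) = t (j + k) := by
  induction k with
  | zero => simpa using h
  | succ k ih =>
    have h1 := hs (i + k)
    have h2 := ht (j + k)
    rw [← ih] at h2
    have := R.right h1 h2
    simpa [add_assoc] using this

theorem range_subset_of_cycles {l : ℕ} [NeZero l] {R : PInj α α} {s : ZMod l ↪ α}
    (hs : s ∈ cycles l R) {m : ℕ} {t : ZMod m ↪ α} (ht : t ∈ cycles m R) {i : ZMod l} {j : ZMod m}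
    (h : s i = t j) : Set.range s ⊆ Set.range t := by
  rintro _ ⟨x, rfl⟩
  have := cycles_apply_add hs ht h (x - i).val
  rw [ZMod.natCast_zmod_val, add_sub_cancel] at this
  exact ⟨_, this.symm⟩

theorem length_eq_of_cycles {l : ℕ} [NeZero l] {R : PInj α α} {s : ZMod l ↪ α}
    (hs : s ∈ cycles l R) {m : ℕ} [NeZero m] {t : ZMod m ↪ α} (ht : t ∈ cycles m R) {i : ZMod l}
    {j : ZMod m} (h : s i = t j) : l = m := by
  have hr := (range_subset_of_cycles hs ht h).antisymm (range_subset_of_cycles ht hs h.symm)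
  have := congrArg (fun S : Set α => Nat.card S) hr
  simpa [Nat.card_range_of_injective s.injective, Nat.card_range_of_injective t.injective]
    using this

/-- Based cycles that meet have the same points and length, so the second is determined by where its
base point sits on the first: `l` choices. -/
theorem ncard_meeting_cycles_le [Finite α] {l m : ℕ} [NeZero l] [NeZero m] (R : PInj α α) :
    {p : (ZMod l ↪ α) × (ZMod m ↪ α) |
      p.1 ∈ cycles l R ∧ p.2 ∈ cycles m R ∧ ∃ i j, p.1 i = p.2 j}.ncard ≤
      if l = m then l * (cycles l R).ncard else 0 := by
  split_ifs with hlm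
  · subst hlm
    have hmul : l * (cycles l R).ncard = (cycles l R ×ˢ (Set.univ : Set (ZMod l))).ncard := by
      rw [Set.ncard_prod, Set.ncard_univ, Nat.card_zmod, mul_comm]
    rw [hmul]
    -- Stated for all pairs so that the position `k` becomes a total function; off the meeting pairs
    -- it takes the default value `0`.
    have hex (p : (ZMod l ↪ α) × (ZMod l ↪ α)) : ∃ k, p.1 ∈ cycles l R → p.2 ∈ cycles l R →
        (∃ i j, p.1 i = p.2 j) → p.1 k = p.2 0 := by
      by_cases h : p.1 ∈ cycles l R ∧ p.2 ∈ cycles l R ∧ ∃ i j, p.1 i = p.2 j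
      · obtain ⟨h1, h2, i, j, hij⟩ := h
        obtain ⟨k, hk⟩ := range_subset_of_cycles h2 h1 hij.symm ⟨0, rfl⟩
        exact ⟨k, fun _ _ _ => hk⟩
      · exact ⟨0, fun h1 h2 h3 => absurd ⟨h1, h2, h3⟩ h⟩
    choose k hk using hex
    refine Set.ncard_le_ncard_of_injOn (fun p => (p.1, k p)) ?_ ?_
    · rintro ⟨s, t⟩ ⟨h1, -, -⟩
      exact ⟨h1, trivial⟩
    · rintro ⟨s, t⟩ ⟨h1, h2, h3⟩ ⟨s', t'⟩ ⟨h1', h2', h3'⟩ heq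
      obtain ⟨rfl, hkk⟩ := Prod.mk.inj heq
      have e1 := hk _ h1 h2 h3
      have e2 := hk _ h1' h2' h3'
      have e : t 0 = t' 0 := e1.symm.trans ((congrArg s hkk).trans e2)
      refine Prod.ext rfl (Function.Embedding.ext fun x => ?_)
      have := cycles_apply_add h2 h2' e x.val
      simpa using this
  · rw [Nat.le_zero, Set.ncard_eq_zero (Set.toFinite _)]
    refine Set.eq_empty_of_forall_notMem ?_
    rintro ⟨s, t⟩ ⟨h1, h2, i, j, hij⟩
    exact hlm (length_eq_of_cycles h1 h2 hij)

theorem sum_ncard_cycles_mul_le (l m : ℕ) [NeZero l] [NeZero m] :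
    ∑ R : PInj (Fin n) (Fin n), ((cycles l R).ncard : ℝ) * (cycles m R).ncard ≤
      count n * (1 + if l = m then (l : ℝ) else 0) := by
  have h1 (R : PInj (Fin n) (Fin n)) : ((cycles l R).ncard : ℝ) * (cycles m R).ncard ≤
      (copies (Equiv.sumCongr (Equiv.addRight (1 : ZMod l)) (Equiv.addRight (1 : ZMod m))) R).ncard +
        (if l = m then (l : ℝ) else 0) * (cycles l R).ncard := by
    have hsub : cycles l R ×ˢ cycles m R ⊆
        {p | p.1 ∈ cycles l R ∧ p.2 ∈ cycles m R ∧ ∀ i j, p.1 i ≠ p.2 j} ∪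
        {p | p.1 ∈ cycles l R ∧ p.2 ∈ cycles m R ∧ ∃ i j, p.1 i = p.2 j} := by
      rintro p ⟨hp1, hp2⟩
      by_cases h : ∃ i j, p.1 i = p.2 j
      · exact Or.inr ⟨hp1, hp2, h⟩
      · push Not at h
        exact Or.inl ⟨hp1, hp2, h⟩
    have h2 := (Set.ncard_le_ncard hsub).trans ((Set.ncard_union_le _ _).trans
      (add_le_add (ncard_disjoint_copies_le _ _ R) (ncard_meeting_cycles_le R)))
    rw [Set.ncard_prod] at h2
    have h3 := (Nat.cast_le (α := ℝ)).2 h2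
    rw [Nat.cast_mul, Nat.cast_add] at h3
    refine h3.trans (le_of_eq ?_)
    split_ifs <;> simp
  refine (Finset.sum_le_sum fun R _ => h1 R).trans ?_
  rw [Finset.sum_add_distrib, ← Finset.mul_sum, sum_ncard_copies, sum_ncard_copies, mul_add,
    mul_left_comm]
  have hc : (0 : ℝ) ≤ count n := by positivity
  gcongr
  · exact meanCopies_le_one _ _
  · refine mul_le_of_le_one_right ?_ (meanCopies_le_one _ _)
    split_ifs <;> positivity

/-- The partial injections without a cycle whose length is in `L`. -/
def noCycle (n : ℕ) (L : Finset ℕ) : Set (PInj (Fin n) (Fin n)) :=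
  {R | ∀ l ∈ L, cycles l R = ∅}

/-- Chebyshev's inequality for `X`, the number of cycles with length in `L`, where the weight `1 /
l` forgets the base point. With `a` the sum of the `1 / l`, the second moment is at most `a ^ 2 +
a`, and every `R` in `noCycle n L` contributes `a ^ 2` to the sum of `(X R - a) ^ 2`. -/
theorem density_noCycle_le (n : ℕ) (L : Finset ℕ) (hL : ∀ l ∈ L, 0 < l) :
    density (noCycle n L) * (∑ l ∈ L, (1 / l : ℝ)) ^ 2 ≤
      2 * (∑ l ∈ L, (1 / l : ℝ)) ^ 2 + (∑ l ∈ L, (1 / l : ℝ)) -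
        2 * (∑ l ∈ L, (1 / l : ℝ)) * ∑ l ∈ L, (1 / l : ℝ) * meanCopies n l := by
  classical
  have hc : (0 : ℝ) < count n := by exact_mod_cast count_pos n
  set a := ∑ l ∈ L, (1 / l : ℝ) with ha
  let X (R : PInj (Fin n) (Fin n)) : ℝ := ∑ l ∈ L, (1 / l : ℝ) * (cycles l R).ncard
  have hX1 : ∑ R, X R = count n * ∑ l ∈ L, (1 / l : ℝ) * meanCopies n l := by
    simp only [X]
    rw [Finset.sum_comm, Finset.mul_sum]
    refine Finset.sum_congr rfl fun l hl => ?_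
    have : NeZero l := ⟨(hL l hl).ne'⟩
    rw [← Finset.mul_sum, sum_ncard_copies, ZMod.card]
    ring
  have hX2 : ∑ R, X R ^ 2 ≤ count n * (a ^ 2 + a) := by
    have h1 : ∑ R, X R ^ 2 = ∑ l ∈ L, ∑ m ∈ L, (1 / l : ℝ) * (1 / m) *
        ∑ R : PInj (Fin n) (Fin n), ((cycles l R).ncard : ℝ) * (cycles m R).ncard := by
      simp only [X, sq]
      simp_rw [Finset.sum_mul_sum]
      rw [Finset.sum_comm]
      refine Finset.sum_congr rfl fun l _ => ?_
      rw [Finset.sum_comm]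
      refine Finset.sum_congr rfl fun m _ => ?_
      rw [Finset.mul_sum]
      exact Finset.sum_congr rfl fun R _ => by ring
    have h2 : ∑ l ∈ L, ∑ m ∈ L, (1 / l : ℝ) * (1 / m) *
        ∑ R : PInj (Fin n) (Fin n), ((cycles l R).ncard : ℝ) * (cycles m R).ncard ≤
        ∑ l ∈ L, ∑ m ∈ L, (1 / l : ℝ) * (1 / m) * (count n * (1 + if l = m then (l : ℝ) else 0)) := by
      refine Finset.sum_le_sum fun l hl => Finset.sum_le_sum fun m hm => ?_
      have : NeZero l := ⟨(hL l hl).ne'⟩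
      have : NeZero m := ⟨(hL m hm).ne'⟩
      gcongr
      exact sum_ncard_cycles_mul_le l m
    rw [h1]
    refine h2.trans (le_of_eq ?_)
    have h3 (l : ℕ) (hl : l ∈ L) : ∑ m ∈ L, (1 / l : ℝ) * (1 / m) *
        (count n * (1 + if l = m then (l : ℝ) else 0)) =
        count n * ((1 / l : ℝ) * a + 1 / l) := by
      have h0 : (l : ℝ) ≠ 0 := by exact_mod_cast (hL l hl).ne'
      have h4 (m : ℕ) : (1 / l : ℝ) * (1 / m) * (count n * (1 + if l = m then (l : ℝ) else 0)) =
          count n * ((1 / l) * (1 / m)) + if l = m then count n * (1 / l : ℝ) else 0 := by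
        split_ifs with h
        · subst h
          field_simp
        · ring
      simp only [h4]
      rw [Finset.sum_add_distrib, Finset.sum_ite_eq, if_pos hl, ← Finset.mul_sum, ← Finset.mul_sum]
      ring
    rw [Finset.sum_congr rfl h3, ← Finset.mul_sum, Finset.sum_add_distrib, ← Finset.sum_mul, sq]
  have hvar : ((noCycle n L).ncard : ℝ) * a ^ 2 ≤ ∑ R, (X R - a) ^ 2 := by
    rw [Set.ncard_eq_toFinset_card', ← nsmul_eq_mul]
    refine le_trans ?_ (Finset.sum_le_sum_of_subset_of_nonneg
      (Finset.subset_univ (noCycle n L).toFinset) fun R _ _ => sq_nonneg (X R - a))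
    refine Finset.card_nsmul_le_sum _ _ _ fun R hR => ?_
    have hR' : R ∈ noCycle n L := by simpa using hR
    have : X R = 0 := Finset.sum_eq_zero fun l hl => by rw [hR' l hl]; simp
    rw [this, zero_sub, neg_sq]
  have hexp : ∑ R, (X R - a) ^ 2 = ∑ R, X R ^ 2 - 2 * a * ∑ R, X R + count n * a ^ 2 := by
    simp only [sub_sq]
    rw [Finset.sum_add_distrib, Finset.sum_sub_distrib, Finset.sum_const, Finset.card_univ,
      ← Nat.card_eq_fintype_card, card_eq, nsmul_eq_mul, Finset.mul_sum]
    congr 2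
    exact Finset.sum_congr rfl fun R _ => by ring
  rw [density, card_eq, div_mul_eq_mul_div, div_le_iff₀ hc]
  calc ((noCycle n L).ncard : ℝ) * a ^ 2
      ≤ count n * (a ^ 2 + a) - 2 * a * ∑ R, X R + count n * a ^ 2 := by linarith
    _ = _ := by rw [hX1]; ring

/-- As `n` grows, `meanCopies` tends to `1` and the Chebyshev bound tends to the reciprocal of the
sum. -/
theorem eventually_density_noCycle_le (L : Finset ℕ) (hL : ∀ l ∈ L, 0 < l) {ε : ℝ} (hε : 0 < ε)
    (h : 1 / ε < ∑ l ∈ L, (1 / l : ℝ)) : ∀ᶠ n in atTop, density (noCycle n L) < ε := by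
  have hpos : 0 < ∑ l ∈ L, (1 / l : ℝ) := lt_trans (by positivity) h
  have hlim : Tendsto (fun n => 2 * (∑ l ∈ L, (1 / l : ℝ)) ^ 2 + (∑ l ∈ L, (1 / l : ℝ)) -
        2 * (∑ l ∈ L, (1 / l : ℝ)) * ∑ l ∈ L, (1 / l : ℝ) * meanCopies n l) atTop
      (nhds (2 * (∑ l ∈ L, (1 / l : ℝ)) ^ 2 + (∑ l ∈ L, (1 / l : ℝ)) -
        2 * (∑ l ∈ L, (1 / l : ℝ)) * ∑ l ∈ L, (1 / l : ℝ) * 1)) :=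
    tendsto_const_nhds.sub (tendsto_const_nhds.mul
      (tendsto_finsetSum _ fun l _ => tendsto_const_nhds.mul (tendsto_meanCopies l)))
  rw [show 2 * (∑ l ∈ L, (1 / l : ℝ)) ^ 2 + (∑ l ∈ L, (1 / l : ℝ)) -
        2 * (∑ l ∈ L, (1 / l : ℝ)) * ∑ l ∈ L, (1 / l : ℝ) * 1 = ∑ l ∈ L, (1 / l : ℝ) by
      simp only [mul_one]; ring] at hlim
  have hlt : ∑ l ∈ L, (1 / l : ℝ) < ε * (∑ l ∈ L, (1 / l : ℝ)) ^ 2 := by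
    rw [div_lt_iff₀ hε] at h
    nlinarith
  filter_upwards [hlim.eventually (gt_mem_nhds hlt)] with n hn
  exact lt_of_mul_lt_mul_right ((density_noCycle_le n L hL).trans_lt hn) (sq_nonneg _)

theorem exists_primes_sum_gt (N : ℕ) (C : ℝ) :
    ∃ L : Finset ℕ, (∀ p ∈ L, p.Prime ∧ N < p) ∧ C < ∑ p ∈ L, (1 / p : ℝ) := by
  classical
  have h := (not_summable_iff_tendsto_nat_atTop_of_nonneg (fun n => by
    unfold Set.indicator
    split_ifs <;> positivity)).1 not_summable_one_div_on_primes
  obtain ⟨M, hM⟩ := (h.eventually (eventually_gt_atTop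
    (C + ∑ i ∈ Finset.range (N + 1), Set.indicator {p : ℕ | p.Prime} (fun n : ℕ => (1 : ℝ) / n) i))).exists
  refine ⟨(Finset.range M).filter fun p => p.Prime ∧ N < p, fun p hp => (Finset.mem_filter.1 hp).2, ?_⟩
  have hle : ∑ i ∈ Finset.range M, Set.indicator {p : ℕ | p.Prime} (fun n : ℕ => (1 : ℝ) / n) i ≤
      (∑ p ∈ (Finset.range M).filter fun p => p.Prime ∧ N < p, (1 / p : ℝ)) +
        ∑ i ∈ Finset.range (N + 1), Set.indicator {p : ℕ | p.Prime} (fun n : ℕ => (1 : ℝ) / n) i := by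
    have hnn (i : ℕ) : 0 ≤ Set.indicator {p : ℕ | p.Prime} (fun n : ℕ => (1 : ℝ) / n) i :=
      Set.indicator_nonneg (fun _ _ => by positivity) i
    rw [Finset.sum_filter]
    calc _ ≤ ∑ i ∈ Finset.range M, ((if i.Prime ∧ N < i then (1 / i : ℝ) else 0) +
          if i ∈ Finset.range (N + 1) then
            Set.indicator {p : ℕ | p.Prime} (fun n : ℕ => (1 : ℝ) / n) i else 0) := by
          refine Finset.sum_le_sum fun i _ => ?_
          by_cases hN : N < i
          · have hN' : ¬ i < N + 1 := by omega
            simp [Set.indicator, hN, hN']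
          · have hN' : i < N + 1 := by omega
            simp [Set.indicator, hN, hN']
      _ ≤ _ := by
          rw [Finset.sum_add_distrib, Finset.sum_ite_mem]
          exact add_le_add le_rfl (Finset.sum_le_sum_of_subset_of_nonneg
            Finset.inter_subset_right fun i _ _ => hnn i)
  linarith

/-- The partial injections with two cycles of coprime lengths. -/
def coprimeCycles (n : ℕ) : Set (PInj (Fin n) (Fin n)) :=
  {R | ∃ l m : ℕ, l.Coprime m ∧ (cycles l R).Nonempty ∧ (cycles m R).Nonempty}

theorem tendsto_density_coprimeCycles_compl :
    Tendsto (fun n => density (coprimeCycles n)ᶜ) atTop (nhds 0) := by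
  refine tendsto_order.2 ⟨fun a ha => Eventually.of_forall fun n => ha.trans_le (density_nonneg _),
    fun ε hε => ?_⟩
  obtain ⟨L, hL, hLsum⟩ := exists_primes_sum_gt 0 (1 / (ε / 2))
  -- All primes of `M` exceed those of `L`, so a length from each set gives distinct, hence coprime,
  -- primes.
  obtain ⟨M, hM, hMsum⟩ := exists_primes_sum_gt (L.sup id) (1 / (ε / 2))
  filter_upwards [eventually_density_noCycle_le L (fun l hl => (hL l hl).1.pos) (half_pos hε) hLsum,
    eventually_density_noCycle_le M (fun l hl => (hM l hl).1.pos) (half_pos hε) hMsum] with n h1 h2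
  have hsub : (coprimeCycles n)ᶜ ⊆ noCycle n L ∪ noCycle n M := by
    intro R hR
    by_contra hcon
    simp only [noCycle, Set.mem_union, Set.mem_ofPred_eq, not_or, not_forall] at hcon
    obtain ⟨⟨l, hl, hle⟩, ⟨m, hm, hme⟩⟩ := hcon
    refine hR ⟨l, m, ?_, Set.nonempty_iff_ne_empty.2 hle, Set.nonempty_iff_ne_empty.2 hme⟩
    rw [Nat.coprime_primes (hL l hl).1 (hM m hm).1]
    exact ((Finset.le_sup (f := id) hl).trans_lt (hM m hm).2).ne
  linarith [(density_mono hsub).trans (density_union_le _ _)]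

end PInj

/-! ### Relabelling, representations of a subgroup, and the normal closure. -/

namespace AGraph

open FreeGroup

variable {A V V' : Type*}

/-- Transporting an `A`-graph along a bijection of the vertices. -/
def relabel (Γ : AGraph A V) (e : V ≃ V') : AGraph A V' where
  edges := {x | (e.symm x.1, x.2.1, e.symm x.2.2) ∈ Γ.edges}
  det _ _ _ _ h h' := e.symm.injective (Γ.det _ _ _ _ h h')
  codet _ _ _ _ h h' := e.symm.injective (Γ.codet _ _ _ _ h h')

theorem relabel_step (Γ : AGraph A V) (e : V ≃ V') (u w : V) (x : A × Bool) :
    (Γ.relabel e).Step (e u) x (e w) ↔ Γ.Step u x w := by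
  obtain ⟨a, b⟩ := x
  cases b <;> simp [Step, relabel]

theorem relabel_reads (Γ : AGraph A V) (e : V ≃ V') (L : List (A × Bool)) (u w : V) :
    (Γ.relabel e).Reads L (e u) (e w) ↔ Γ.Reads L u w := by
  induction L generalizing u with
  | nil => exact e.injective.eq_iff
  | cons x L ih =>
    constructor
    · rintro ⟨z, h1, h2⟩
      obtain ⟨z, rfl⟩ := e.surjective z
      exact ⟨z, (Γ.relabel_step e u z x).1 h1, (ih z).1 h2⟩
    · rintro ⟨z, h1, h2⟩
      exact ⟨e z, (Γ.relabel_step e u z x).2 h1, (ih z).2 h2⟩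

theorem relabel_subgroupAt (Γ : AGraph A V) (e : V ≃ V') (v : V) :
    (Γ.relabel e).subgroupAt (e v) = Γ.subgroupAt v := by
  ext g
  exact exists_congr fun L => and_congr_right fun _ => Γ.relabel_reads e L v v

theorem relabel_isLeaf (Γ : AGraph A V) (e : V ≃ V') (v : V) :
    (Γ.relabel e).IsLeaf (e v) ↔ Γ.IsLeaf v := by
  have h1 : {p : A × V' | (e v, p.1, p.2) ∈ (Γ.relabel e).edges}.encard =
      {p : A × V | (v, p.1, p.2) ∈ Γ.edges}.encard := by
    rw [← Set.encard_preimage_of_bijective ((Equiv.refl A).prodCongr e).bijective]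
    congr 1
    ext p
    simp [relabel]
  have h2 : {p : V' × A | (p.1, p.2, e v) ∈ (Γ.relabel e).edges}.encard =
      {p : V × A | (p.1, p.2, v) ∈ Γ.edges}.encard := by
    rw [← Set.encard_preimage_of_bijective (e.prodCongr (Equiv.refl A)).bijective]
    congr 1
    ext p
    simp [relabel]
  rw [IsLeaf, degree, h1, h2, IsLeaf, degree]

/-- Relabelling induces an isomorphism of the underlying graphs. -/
def relabelIso (Γ : AGraph A V) (e : V ≃ V') : Γ.toSimpleGraph ≃g (Γ.relabel e).toSimpleGraph where
  toEquiv := e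
  map_rel_iff' := by
    intro u w
    simp [toSimpleGraph, relabel]

theorem Admissible.relabel {Γ : AGraph A V} {v : V} (h : Γ.Admissible v) (e : V ≃ V') :
    (Γ.relabel e).Admissible (e v) where
  finite := have := h.finite; Finite.of_equiv V e
  connected := (Γ.relabelIso e).connected_iff.1 h.connected
  trim w hw := by
    obtain ⟨w, rfl⟩ := e.surjective w
    rw [relabel_isLeaf]
    exact h.trim w fun hwv => hw (congrArg e hwv)

/-- By connectedness every vertex is the end of a word read from `v`, and that word has only one end
in the relabelled graph. -/
theorem Admissible.relabel_injective {Γ : AGraph A V} {v : V} (h : Γ.Admissible v)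
    {e e' : V ≃ V'} (hv : e v = e' v) (he : Γ.relabel e = Γ.relabel e') : e = e' := by
  ext u
  obtain ⟨L, hL⟩ := h.exists_reads v u
  have h1 := (Γ.relabel_reads e L v u).2 hL
  have h2 := (Γ.relabel_reads e' L v u).2 hL
  rw [← hv, ← he] at h2
  exact reads_unique _ L _ _ _ h1 h2

/-- The subgroups represented by the admissible graphs on `V` with base vertex `v` all have the
same number of representations. -/
theorem ncard_admissible_subgroupAt [Finite V] (v : V) (Y : Set (Subgroup (FreeGroup A))) :
    {Γ : AGraph A V | Γ.Admissible v ∧ Γ.subgroupAt v ∈ Y}.ncard =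
      (Y ∩ {H | ∃ Γ : AGraph A V, Γ.Admissible v ∧ Γ.subgroupAt v = H}).ncard *
        Nat.card {σ : Equiv.Perm V // σ v = v} := by
  rw [← Nat.card_coe_set_eq, ← Nat.card_coe_set_eq, ← Nat.card_prod]
  -- One graph per subgroup is fixed; its relabellings by the permutations fixing `v` are distinct
  -- and, by `Admissible.exists_equiv`, exhaust the graphs of that subgroup.
  choose G hG hGH using fun H : (Y ∩ {H | ∃ Γ : AGraph A V, Γ.Admissible v ∧ Γ.subgroupAt v = H} :
    Set (Subgroup (FreeGroup A))) => H.2.2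
  have hadm (p : (Y ∩ {H | ∃ Γ : AGraph A V, Γ.Admissible v ∧ Γ.subgroupAt v = H} :
      Set (Subgroup (FreeGroup A))) × {σ : Equiv.Perm V // σ v = v}) :
      (G p.1).relabel p.2.1 ∈ {Γ : AGraph A V | Γ.Admissible v ∧ Γ.subgroupAt v ∈ Y} := by
    have h1 := (hG p.1).relabel p.2.1
    have h2 := (G p.1).relabel_subgroupAt p.2.1 v
    rw [p.2.2] at h1
    rw [p.2.2, hGH] at h2
    exact ⟨h1, h2 ▸ p.1.2.1⟩
  refine (Nat.card_eq_of_bijective (fun p => ⟨(G p.1).relabel p.2.1, hadm p⟩) ⟨?_, ?_⟩).symm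
  · rintro ⟨H, σ, hσ⟩ ⟨H', σ', hσ'⟩ heq
    have heq : (G H).relabel σ = (G H').relabel σ' := congrArg Subtype.val heq
    have h1 := (G H).relabel_subgroupAt σ v
    have h2 := (G H').relabel_subgroupAt σ' v
    rw [hσ, hGH] at h1
    rw [hσ', hGH] at h2
    obtain rfl : H = H' := Subtype.ext (h1.symm.trans ((congrArg (·.subgroupAt v) heq).trans h2))
    obtain rfl := (hG H).relabel_injective (hσ.trans hσ'.symm) heq
    rfl
  · rintro ⟨Γ, hΓ, hY⟩
    let H : (Y ∩ {H | ∃ Γ : AGraph A V, Γ.Admissible v ∧ Γ.subgroupAt v = H} :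
      Set (Subgroup (FreeGroup A))) := ⟨Γ.subgroupAt v, hY, Γ, hΓ, rfl⟩
    obtain ⟨e, hev, he⟩ := (hG H).exists_equiv hΓ (hGH H)
    refine ⟨(H, ⟨e, hev⟩), Subtype.ext ?_⟩
    have hedges : ((G H).relabel e).edges = Γ.edges := by
      ext ⟨x, a, y⟩
      simpa [relabel] using he (e.symm x) a (e.symm y)
    change (G H).relabel e = Γ
    generalize (G H).relabel e = Γ' at hedges
    cases Γ
    cases Γ'
    simpa using hedges

instance [Finite A] [Finite V] : Finite (AGraph A V) :=
  Finite.of_equiv _ equivPInj.symm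

/-- A path `P` from `v` to an `a`-cycle of length `l` puts `P * a ^ l * P⁻¹` in the subgroup, hence
`a ^ l` in its normal closure; Bézout then recovers `a` from two coprime exponents. -/
theorem normalClosure_eq_top {n : ℕ} {F : A → PInj (Fin n) (Fin n)} {v : Fin n}
    (hF : (ofPInj F).Admissible v) (hc : ∀ a, F a ∈ PInj.coprimeCycles n) :
    Subgroup.normalClosure ((ofPInj F).subgroupAt v : Set (FreeGroup A)) = ⊤ := by
  classical
  set N := Subgroup.normalClosure ((ofPInj F).subgroupAt v : Set (FreeGroup A)) with hN
  have hpow (a : A) (l : ℕ) (hl : (PInj.cycles l (F a)).Nonempty) : FreeGroup.of a ^ l ∈ N := by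
    obtain ⟨s, hs⟩ := hl
    have hr (k : ℕ) (i : ZMod l) :
        (ofPInj F).Reads (List.replicate k (a, true)) (s i) (s (i + k)) := by
      induction k generalizing i with
      | zero => simp [Reads]
      | succ k ih =>
        refine ⟨s (i + 1), hs i, ?_⟩
        have := ih (i + 1)
        rwa [add_assoc, add_comm (1 : ZMod l), ← Nat.cast_succ] at this
    have hloop := hr l 0
    rw [ZMod.natCast_self, add_zero] at hloop
    obtain ⟨P, hP⟩ := hF.exists_reads v (s 0)
    have hmem : FreeGroup.mk (P ++ (List.replicate l (a, true) ++ invRev P)) ∈ N :=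
      Subgroup.subset_normalClosure ⟨_, rfl, (reads_append _ _ _ _ _).2
        ⟨_, hP, (reads_append _ _ _ _ _).2 ⟨_, hloop, reads_invRev _ _ _ _ hP⟩⟩⟩
    rw [← mul_mk, ← mul_mk, ← inv_mk, ← mul_assoc] at hmem
    have hNn : N.Normal := Subgroup.normalClosure_normal
    have hmk : FreeGroup.mk (List.replicate l (a, true)) = FreeGroup.of a ^ l := by
      rw [← FreeGroup.toWord_of_pow, FreeGroup.mk_toWord]
    rw [hmk] at hmem
    have hconj := hNn.conj_mem _ hmem (FreeGroup.mk P)⁻¹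
    generalize FreeGroup.mk P = x at hconj
    rwa [show x⁻¹ * (x * FreeGroup.of a ^ l * x⁻¹) * x⁻¹⁻¹ = FreeGroup.of a ^ l by group] at hconj
  rw [eq_top_iff, ← FreeGroup.closure_range_of, Subgroup.closure_le]
  rintro _ ⟨a, rfl⟩
  obtain ⟨l, m, hlm, hl, hm⟩ := hc a
  have h := Nat.gcd_eq_gcd_ab l m
  rw [hlm.gcd_eq_one] at h
  have : FreeGroup.of a =
      (FreeGroup.of a ^ l) ^ Nat.gcdA l m * (FreeGroup.of a ^ m) ^ Nat.gcdB l m := by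
    rw [← zpow_natCast, ← zpow_natCast, ← zpow_mul, ← zpow_mul, ← zpow_add, ← h]
    simp
  rw [SetLike.mem_coe, this]
  exact mul_mem (zpow_mem (hpow a l hl) _) (zpow_mem (hpow a m hm) _)

end AGraph

/-! ### From spheres to balls. -/

theorem ncard_layers {S : Type*} {L : ℕ → Set S} (hfin : ∀ n, (L n).Finite)
    (hdisj : Pairwise fun i j => Disjoint (L i) (L j)) (n : ℕ) :
    (⋃ i ≤ n, L i).ncard = ∑ i ∈ Finset.range (n + 1), (L i).ncard := by
  have h := (Set.finite_Iic n).ncard_biUnion (fun i _ => hfin i) (hdisj.set_pairwise _)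
  rw [finsum_mem_eq_finite_toFinset_sum _ (Set.finite_Iic n)] at h
  refine h.trans (Finset.sum_congr ?_ fun _ _ => rfl)
  ext i
  simp

open Filter Asymptotics in
theorem IsSphereGeneric.isBallGeneric {S : Type*} {L : ℕ → Set S} {X : Set S}
    (h : IsSphereGeneric L X) (hfin : ∀ n, (L n).Finite)
    (hdisj : Pairwise fun i j => Disjoint (L i) (L j)) : IsBallGeneric L X := by
  let f (n : ℕ) : ℝ := (L n).ncard
  let g (n : ℕ) : ℝ := (X ∩ L n).ncard
  -- An empty layer has proportion `0 / 0 = 0`, far from the limit `1`. Layers are thus eventually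
  -- nonempty, which makes the partial sums diverge, as summing equivalents requires.
  have hf0 : ∀ᶠ n in atTop, 1 ≤ f n := by
    filter_upwards [h.eventually (lt_mem_nhds one_pos)] with n hn
    have : (L n).ncard ≠ 0 := by
      intro h0
      simp [proportion, h0] at hn
    simp only [f]
    exact_mod_cast Nat.one_le_iff_ne_zero.2 this
  have hequiv : g ~[atTop] f :=
    (isEquivalent_iff_tendsto_one (hf0.mono fun n hn => (one_pos.trans_le hn).ne')).2 h
  have htop : Tendsto (fun n => ∑ i ∈ Finset.range n, f i) atTop atTop := by
    rw [← not_summable_iff_tendsto_nat_atTop_of_nonneg fun n => by positivity]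
    intro hs
    obtain ⟨n, h1, h2⟩ := (hf0.and (hs.tendsto_atTop_zero.eventually (gt_mem_nhds one_pos))).exists
    exact absurd h1 (not_le.2 h2)
  have hsum : (fun n => ∑ i ∈ Finset.range n, g i) ~[atTop] fun n => ∑ i ∈ Finset.range n, f i := by
    have := IsLittleO.sum_range hequiv (fun n => by positivity) htop
    simpa [IsEquivalent, Finset.sum_sub_distrib, Pi.sub_def] using this
  have hlim := (isEquivalent_iff_tendsto_one (htop.eventually (eventually_ne_atTop 0))).1 hsum
  refine (hlim.comp (tendsto_add_atTop_nat 1)).congr fun n => ?_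
  have h1 := ncard_layers hfin hdisj n
  have h2 := ncard_layers (L := fun i => X ∩ L i) (fun n => (hfin n).inter_of_right X)
    (fun i j hij => (hdisj hij).mono Set.inter_subset_right Set.inter_subset_right) n
  simp only [Function.comp_apply, Pi.div_apply, f, g, proportion]
  rw [Set.inter_iUnion₂, h1, h2]
  push_cast
  rfl

/-! ### Stallings graphs as tuples of partial injections, and conclusion. -/

namespace StallingsGraph

variable {A : Type*}

theorem subsingleton_presented_iff (Γ : StallingsGraph A) :
    Subsingleton Γ.Presented ↔ Subgroup.normalClosure (Γ.subgroup : Set (FreeGroup A)) = ⊤ :=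
  QuotientGroup.subsingleton_iff

theorem ncard_preimage_inter_sphere (Y : Set (Subgroup (FreeGroup A))) {n : ℕ} (hn : 0 < n) :
    (subgroup ⁻¹' Y ∩ sphere A n).ncard = {Γ : AGraph A (Fin n) |
      Γ.Admissible ⟨0, hn⟩ ∧ Γ.subgroupAt ⟨0, hn⟩ ∈ Y}.ncard := by
  rw [← Nat.card_coe_set_eq, ← Nat.card_coe_set_eq]
  refine (Nat.card_eq_of_bijective (fun Γ => ⟨⟨n, hn, Γ.1, Γ.2.1⟩, Γ.2.2, rfl⟩)
    ⟨?_, ?_⟩).symm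
  · rintro ⟨Γ, h⟩ ⟨Γ', h'⟩ heq
    have := congrArg Subtype.val heq
    simp only [StallingsGraph.mk.injEq, heq_eq_eq, true_and] at this
    exact Subtype.ext this
  · rintro ⟨⟨m, hm, Γ, hΓ⟩, hX, (rfl : m = n)⟩
    exact ⟨⟨Γ, hΓ, hX⟩, rfl⟩

open AGraph in
theorem ncard_preimage_inter_sphere_eq_ncard_pInj (Y : Set (Subgroup (FreeGroup A))) {n : ℕ}
    (hn : 0 < n) : (subgroup ⁻¹' Y ∩ sphere A n).ncard = {F : A → PInj (Fin n) (Fin n) | ∃ hn : 0 < n,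
      (ofPInj F).Admissible ⟨0, hn⟩ ∧ (ofPInj F).subgroupAt ⟨0, hn⟩ ∈ Y}.ncard := by
  rw [ncard_preimage_inter_sphere Y hn, ← Set.ncard_image_of_injective _ equivPInj.symm.injective]
  congr 1
  ext Γ
  constructor
  · exact fun hΓ => ⟨equivPInj Γ, ⟨hn, hΓ⟩, rfl⟩
  · rintro ⟨F, ⟨_, hF⟩, rfl⟩
    exact hF

theorem finite_sphere [Finite A] (n : ℕ) : (sphere A n).Finite := by
  rcases Nat.eq_zero_or_pos n with rfl | hn
  · refine Set.Finite.subset Set.finite_empty fun Γ hΓ => ?_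
    exact absurd hΓ Γ.size_pos.ne'
  · refine (Set.finite_range fun Γ : {Γ : AGraph A (Fin n) // Γ.Admissible ⟨0, hn⟩} =>
      (⟨n, hn, Γ.1, Γ.2⟩ : StallingsGraph A)).subset ?_
    rintro ⟨m, hm, Γ, hΓ⟩ (rfl : m = n)
    exact ⟨⟨Γ, hΓ⟩, rfl⟩

theorem disjoint_sphere : Pairwise fun i j => Disjoint (sphere A i) (sphere A j) :=
  fun _ _ hij => Set.disjoint_left.2 fun _ hi hj => hij (Eq.trans (Eq.symm hi) hj)

end StallingsGraph

theorem finite_subgroupSphere (A : Type*) [Finite A] (n : ℕ) : (subgroupSphere A n).Finite := by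
  refine ((StallingsGraph.finite_sphere n).image StallingsGraph.subgroup).subset ?_
  rintro _ ⟨Γ, hn, rfl⟩
  exact ⟨Γ, hn, rfl⟩

/-- By rigidity, graphs of the same subgroup have the same number of vertices. -/
theorem disjoint_subgroupSphere (A : Type*) :
    Pairwise fun i j => Disjoint (subgroupSphere A i) (subgroupSphere A j) := by
  intro i j hij
  refine Set.disjoint_left.2 ?_
  rintro _ ⟨Γ, rfl, rfl⟩ ⟨Γ', rfl, h⟩
  obtain ⟨e, -⟩ := Γ.admissible.exists_equiv Γ'.admissible h.symm
  exact hij (by simpa using Fintype.card_congr e)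

theorem subgroupSphere_eq (A : Type*) {n : ℕ} (hn : 0 < n) : subgroupSphere A n =
    {H | ∃ Γ : AGraph A (Fin n), Γ.Admissible ⟨0, hn⟩ ∧ Γ.subgroupAt ⟨0, hn⟩ = H} := by
  ext H
  constructor
  · rintro ⟨⟨m, hm, Γ, hΓ⟩, (rfl : m = n), h⟩
    exact ⟨Γ, hΓ, h⟩
  · rintro ⟨Γ, hΓ, h⟩
    exact ⟨⟨n, hn, Γ, hΓ⟩, rfl, h⟩

/-- Numerator and denominator change by the same factor, the number of permutations fixing the base
vertex. -/
theorem proportion_subgroupSphere (A : Type*) (Y : Set (Subgroup (FreeGroup A))) {n : ℕ}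
    (hn : 0 < n) : proportion Y (subgroupSphere A n) =
      proportion (StallingsGraph.subgroup ⁻¹' Y) (StallingsGraph.sphere A n) := by
  have h1 := StallingsGraph.ncard_preimage_inter_sphere Y hn
  have h2 := StallingsGraph.ncard_preimage_inter_sphere (A := A) Set.univ hn
  rw [AGraph.ncard_admissible_subgroupAt, ← subgroupSphere_eq] at h1 h2
  rw [Set.preimage_univ, Set.univ_inter, Set.univ_inter] at h2
  have : Nonempty {σ : Equiv.Perm (Fin n) // σ ⟨0, hn⟩ = ⟨0, hn⟩} := ⟨⟨1, rfl⟩⟩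
  have hne : (Nat.card {σ : Equiv.Perm (Fin n) // σ ⟨0, hn⟩ = ⟨0, hn⟩} : ℝ) ≠ 0 := by
    exact_mod_cast Nat.card_pos.ne'
  rw [proportion, proportion, h1, h2, Nat.cast_mul, Nat.cast_mul, mul_div_mul_right _ _ hne]

open Filter in
theorem tendsto_density_one {Ω : ℕ → Type*} [∀ n, Finite (Ω n)] [∀ n, Nonempty (Ω n)]
    {X B : ∀ n, Set (Ω n)} (hXB : ∀ᶠ n in atTop, (X n)ᶜ ⊆ B n) {u : ℕ → ℝ}
    (hu : ∀ n, density (B n) ≤ u n) (hlim : Tendsto u atTop (nhds 0)) :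
    Tendsto (fun n => density (X n)) atTop (nhds 1) := by
  have h1 : Tendsto (fun n => 1 - u n) atTop (nhds 1) := by
    simpa using tendsto_const_nhds.sub hlim
  refine tendsto_of_tendsto_of_tendsto_of_le_of_le' h1 tendsto_const_nhds ?_
    (Eventually.of_forall fun n => ?_)
  · filter_upwards [hXB] with n hn
    have h2 := density_union_le (X n) (X n)ᶜ
    rw [Set.union_compl_self, density_univ] at h2
    linarith [density_mono hn, hu n]
  · rw [← density_univ (Ω := Ω n)]
    exact density_mono (Set.subset_univ _)

open Filter AGraph in
/-- Generically, the subgroup represented by a Stallings graph has full normal closure. -/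
theorem isSphereGeneric_normalClosure_eq_top (A : Type*) [Finite A] (hA : 2 ≤ Nat.card A) :
    IsSphereGeneric (StallingsGraph.sphere A)
      (StallingsGraph.subgroup ⁻¹' {H | Subgroup.normalClosure (H : Set (FreeGroup A)) = ⊤}) := by
  have := Fintype.ofFinite A
  have : Nontrivial A := Finite.one_lt_card_iff_nontrivial.1 hA
  obtain ⟨a, b, hab⟩ := exists_pair_ne A
  obtain ⟨K, hK⟩ := PInj.exists_density_invariant_le
  let Y : Set (Subgroup (FreeGroup A)) :=
    {H | Subgroup.normalClosure (H : Set (FreeGroup A)) = ⊤}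
  let adm (n : ℕ) : Set (A → PInj (Fin n) (Fin n)) :=
    {F | ∃ hn : 0 < n, (ofPInj F).Admissible ⟨0, hn⟩}
  let good (n : ℕ) : Set (A → PInj (Fin n) (Fin n)) :=
    {F | ∃ hn : 0 < n, (ofPInj F).Admissible ⟨0, hn⟩ ∧ (ofPInj F).subgroupAt ⟨0, hn⟩ ∈ Y}
  let bad (n : ℕ) : Set (A → PInj (Fin n) (Fin n)) :=
    {F | ∃ S : Set (Fin n), S.Nonempty ∧ 2 * S.ncard ≤ n ∧ ∀ c, F c ∈ PInj.invariant S} ∪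
      {F | ∃ v, (ofPInj F).IsLeaf v} ∪ ⋃ c, {F | F c ∈ (PInj.coprimeCycles n)ᶜ}
  let u (n : ℕ) : ℝ := K / n + 4 * (1 - PInj.ratio n) +
    Fintype.card A * density (PInj.coprimeCycles n)ᶜ
  have hu (n : ℕ) : density (bad n) ≤ u n := by
    refine (density_union_le _ _).trans (add_le_add ((density_union_le _ _).trans
      (add_le_add (hK A a b hab n) (density_leaf_le hab n))) ((density_iUnion_le _).trans ?_))
    simp only [density_eval]
    simp
  have hlim : Tendsto u atTop (nhds 0) := by
    have h1 := ((tendsto_const_div_atTop_nhds_zero_nat K).add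
      ((PInj.tendsto_ratio.const_sub 1).const_mul 4)).add
      (PInj.tendsto_density_coprimeCycles_compl.const_mul (Fintype.card A : ℝ))
    simpa using h1
  have hadm {n : ℕ} (hn : 0 < n) {F : A → PInj (Fin n) (Fin n)} (hF : F ∉ bad n) :
      (ofPInj F).Admissible ⟨0, hn⟩ := by
    refine ⟨inferInstance, ?_, fun w _ hw => hF (Or.inl (Or.inr ⟨w, hw⟩))⟩
    by_contra hcon
    exact hF (Or.inl (Or.inl (exists_invariant_of_not_connected hn F hcon)))
  have hsub_good : ∀ᶠ n in atTop, (good n)ᶜ ⊆ bad n := by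
    filter_upwards [eventually_gt_atTop 0] with n hn F hF
    by_contra hbad
    refine hF ⟨hn, hadm hn hbad, normalClosure_eq_top (hadm hn hbad) fun c => ?_⟩
    by_contra hc
    exact hbad (Or.inr (Set.mem_iUnion.2 ⟨c, hc⟩))
  have hsub_adm : ∀ᶠ n in atTop, (adm n)ᶜ ⊆ bad n :=
    hsub_good.mono fun n h F hF => h fun hg => hF ⟨hg.1, hg.2.1⟩
  -- The proportion among Stallings graphs is a conditional probability: the density of good tuples
  -- over that of admissible ones, both tending to `1`.
  have h := (tendsto_density_one hsub_good hu hlim).div (tendsto_density_one hsub_adm hu hlim)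
    one_ne_zero
  rw [div_one] at h
  refine h.congr' ?_
  filter_upwards [eventually_gt_atTop 0] with n hn
  have hc : (Nat.card (A → PInj (Fin n) (Fin n)) : ℝ) ≠ 0 := by exact_mod_cast Nat.card_pos.ne'
  have h1 := StallingsGraph.ncard_preimage_inter_sphere_eq_ncard_pInj Y hn
  have h2 := StallingsGraph.ncard_preimage_inter_sphere_eq_ncard_pInj (A := A) Set.univ hn
  simp only [Set.preimage_univ, Set.mem_univ, and_true, Set.univ_inter] at h2
  change density (good n) / density (adm n) = _
  rw [proportion, h1, h2, density, density, div_div_div_cancel_right₀ hc]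

theorem mainTheorem4 (A : Type*) [Finite A] (hA : 2 ≤ Nat.card A) :
    (IsSphereGeneric (StallingsGraph.sphere A) {Γ | Subsingleton Γ.Presented} ∧
      IsBallGeneric (StallingsGraph.sphere A) {Γ | Subsingleton Γ.Presented}) ∧
    (IsSphereGeneric (subgroupSphere A)
        {H | Subgroup.normalClosure (H : Set (FreeGroup A)) = ⊤} ∧
      IsBallGeneric (subgroupSphere A)
        {H | Subgroup.normalClosure (H : Set (FreeGroup A)) = ⊤}) := by
  have h := isSphereGeneric_normalClosure_eq_top A hA
  have hgraph : IsSphereGeneric (StallingsGraph.sphere A) {Γ | Subsingleton Γ.Presented} := by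
    simp only [StallingsGraph.subsingleton_presented_iff]
    exact h
  have hsubgroup : IsSphereGeneric (subgroupSphere A)
      {H | Subgroup.normalClosure (H : Set (FreeGroup A)) = ⊤} := by
    refine Filter.Tendsto.congr' ?_ h
    filter_upwards [Filter.eventually_gt_atTop 0] with n hn
    exact (proportion_subgroupSphere A _ hn).symm
  exact ⟨⟨hgraph, hgraph.isBallGeneric StallingsGraph.finite_sphere StallingsGraph.disjoint_sphere⟩,
    hsubgroup, hsubgroup.isBallGeneric (finite_subgroupSphere A) (disjoint_subgroupSphere A)⟩
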